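/- Let $G=(V,E)$ be a finite connected undirected graph (without loops) with symmetric positive real edge weights $\omega(i,j)$ (all equal to $1$ in the unweighted case; put $\omega(i,j)=0$ if $\{i,j\}\notin E$). Consider the random walk on $G$ which moves from $i$ to $j$ with probability $p_{ij}=\omega(i,j)/\sum_l\omega(i,l)$ (if $|V|=1$ the walk stays where it is). The hitting time $h_{x,A}$ is the expected number of steps until the first visit to $A$ of the walk started at $x$, and the cover time $C_i(G)$ is the expected number of steps until the walk started at $i$ has visited all vertices. Let $\mathcal G$ be the directed graph on the pairs $(P,i)$, $P\subseteq V$, $i\in V$, with the walk that moves from $(P,i)$ to $(P\cup\{j\},j)$ with probability $p_{ij}$, and let all states $(V,k)$ be identified to one state $f$. Write $h_{(P,i),f}$ for the hitting time of $f$ in $\mathcal G$. For $P\subsetneq V$ let $p(P,i,j)$ be the probability that $j$ is the first vertex outside $P$ hit by the walk on $G$ started at $i$, and, for $i \in P$, let $s(P,i)$ be the expected time the walk started at $i$ stays in $P$, i.e. the expected number of steps from a vertex of $P$ to a vertex of $P$ made before the walk leaves $P$ for the first time. Then: 1. $C_i(G)=h_{(\{i\},i),f}$ for every $i\in V$, and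 $h_{(V,i),f}=0$. 2. For all $i\in P\subsetneq V$, $h_{(P,i),f}$ is finite and $$h_{(P,i),f}=1+s(P,i)+\sum_{j\in V\setminus P}p(P,i,j)\,h_{(P\cup\{j\},j),f}.$$ 3. For all $i\in P\subsetneq V$, $1+s(P,i)=h_{i,V\setminus P}$ is the hitting time of $V\setminus P$ from $i$ in $G$. 4. For all $P\subsetneq V$ and $j\in V\setminus P$, the function $i\mapsto p(P,i,j)$ is the potential for the conductances $\omega$ when $j$ has potential $1$ and all other vertices of $V\setminus P$ have potential $0$: it is the unique $\varphi:V\to\mathbb R$ with $\varphi(j)=1$, $\varphi(k)=0$ for $k\in V\setminus(P\cup\{j\})$, and $\sum_l\omega(k,l)(\varphi(k)-\varphi(l))=0$ for all $k\in P$. 5. There is an algorithm which, given $n$, a connected weighted graph $G$ on $\{0,\dots,n-1\}$ by its matrix of weights, and a starting vertex $i$, computes $C_i(G)$ in time $O(n^32^n)$. Precisely: there are one fixed program for a real random-access machine (unit cost for $+,-,\times,/$ and comparison of real numbers, for $+,-$ and comparison of natural numbers, and for array access) and one constant $C$ such that, for every $n$ and every such input, the program halts with output $C_i(G)$ after at most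 $C\,n^3 2^n$ steps. -/

import Mathlib

open MeasureTheory ProbabilityTheory
open scoped ENNReal

noncomputable section

/-! ### Markov chains with countable state space -/

section MarkovChain

variable {S : Type*} [Countable S] [MeasurableSpace S] [MeasurableSingletonClass S]

/-- The transition kernel, from trajectories up to time `n` to states at time `n + 1`, of the Markov
chain whose transition probabilities out of a state `b` are given by `step b`. -/
def chainKernel (step : S → PMF S) (n : ℕ) : Kernel (Finset.Iic n → S) S :=
  (Kernel.ofFunOfCountable fun b => (step b).toMeasure).comap
    (fun h : (Finset.Iic n → S) => h ⟨n, Finset.mem_Iic.2 le_rfl⟩) (measurable_pi_apply _)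

instance (step : S → PMF S) (n : ℕ) : IsMarkovKernel (chainKernel step n) :=
  ⟨fun h => inferInstanceAs
    (IsProbabilityMeasure (step (h ⟨n, Finset.mem_Iic.2 le_rfl⟩)).toMeasure)⟩

/-- The law on the space of trajectories `ℕ → S` of the time-homogeneous Markov chain which is at
`a` at time `0` and whose transition probabilities out of a state `b` are given by `step b`. -/
def chainLaw (step : S → PMF S) (a : S) : Measure (ℕ → S) :=
  Kernel.traj (X := fun _ => S) (chainKernel step) 0 (fun _ => a)

end MarkovChain

/-- The first time at which `E` holds, and `∞` if `E` never holds. -/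
def firstTime (E : ℕ → Prop) : ℝ≥0∞ := ⨅ (t : ℕ) (_ : E t), (t : ℝ≥0∞)

/-- The hitting time `h_{a,A}` of the set `A` from `a`: the expected number of steps which the
Markov chain makes until its first visit to `A`. -/
def hittingTime {S : Type*} [Countable S] [MeasurableSpace S] [MeasurableSingletonClass S]
    (step : S → PMF S) (a : S) (A : Set S) : ℝ≥0∞ :=
  ∫⁻ x, firstTime (fun t => x t ∈ A) ∂(chainLaw step a)

/-! ### Weighted graphs and their random walks -/

/-- A simple undirected graph whose edges carry positive real weights. -/
structure WeightedGraph (V : Type*) where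
  graph : SimpleGraph V
  weight : V → V → ℝ
  weight_symm : ∀ i j, weight i j = weight j i
  weight_pos : ∀ i j, graph.Adj i j → 0 < weight i j
  weight_eq_zero : ∀ i j, ¬ graph.Adj i j → weight i j = 0

namespace WeightedGraph

variable {V : Type*} [Fintype V]

open Classical in
/-- One step of the random walk: from `i` the token moves to `j` with probability
`ω(i,j) / ω(i)`, where `ω(i) = ∑ j, ω(i,j)`. (An isolated vertex, which in a connected graph can
only be the single vertex of a one-vertex graph, keeps the token.) -/
def step (G : WeightedGraph V) (i : V) : PMF V :=
  if h : (∑' j, ENNReal.ofReal (G.weight i j)) = 0 then PMF.pure i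
  else PMF.normalize (fun j => ENNReal.ofReal (G.weight i j)) h
    (by rw [tsum_fintype]; exact ENNReal.sum_ne_top.2 fun _ _ => ENNReal.ofReal_ne_top)

variable [MeasurableSpace V] [MeasurableSingletonClass V]

/-- The cover time `C_i(G)`: the expected number of steps which the random walk started at `i`
makes until it has visited every vertex. -/
def coverTime (G : WeightedGraph V) (i : V) : ℝ≥0∞ :=
  ∫⁻ x, firstTime (fun t => ∀ v, ∃ u ≤ t, x u = v) ∂(chainLaw G.step i)

/-- `p(P,i,j)`: the probability that the first vertex outside `P` which is hit by the random walk
started at `i` is `j`. -/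
def exitProb (G : WeightedGraph V) (P : Finset V) (i j : V) : ℝ≥0∞ :=
  chainLaw G.step i {x | ∃ t, (∀ u < t, x u ∈ P) ∧ x t ∉ P ∧ x t = j}

/-- `s(P,i)`: the expected time the random walk started at `i` stays in `P`, that is, the expected
number of steps inside `P` (from a vertex of `P` to a vertex of `P`) which it makes before it
leaves `P` for the first time. -/
def stayTime (G : WeightedGraph V) (P : Finset V) (i : V) : ℝ≥0∞ :=
  ∫⁻ x, (({t : ℕ | ∀ u ≤ t + 1, x u ∈ P}.encard : ℕ∞) : ℝ≥0∞) ∂(chainLaw G.step i)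

/-- `φ` is the electrical potential, for the conductances `ω`, when `j` is held at potential `1`
and all other vertices outside `P` are held at potential `0`: at every vertex `k` of `P`
Kirchhoff's current law holds, so that `φ` is harmonic there. -/
def IsPotential (G : WeightedGraph V) (P : Finset V) (j : V) (φ : V → ℝ) : Prop :=
  φ j = 1 ∧ (∀ k, k ∉ P → k ≠ j → φ k = 0) ∧
    ∀ k ∈ P, ∑ l, G.weight k l * (φ k - φ l) = 0

variable [DecidableEq V]

/-- One step of the walk on the associated directed graph `𝒢`, whose vertices are the pairs
`(P, i)` of a set `P` of already visited vertices and the current location `i` of the token.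
The token moves from `(P, i)` to `(P ∪ {j}, j)` (which is `(P, j)` if `j ∈ P`) with the probability
with which the random walk on `G` moves from `i` to `j`. -/
def assocStep (G : WeightedGraph V) (y : Finset V × V) : PMF (Finset V × V) :=
  (G.step y.2).map fun j => (insert j y.1, j)

/-- The set of the states `(V, k)` in which all vertices have been visited, which are identified
to the single absorbing state `f`. -/
def covered (V : Type*) [Fintype V] : Set (Finset V × V) := {y | y.1 = Finset.univ}

/-- `h_{(P,i),f}`: the hitting time to `f` from `(P, i)` in the associated graph `𝒢`. -/
def hitCovered (G : WeightedGraph V) (P : Finset V) (i : V) : ℝ≥0∞ :=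
  hittingTime G.assocStep (P, i) (covered V)

end WeightedGraph

/-! ### Programs on a real random-access machine

The machine has registers and arrays for natural numbers and for real numbers. Natural numbers
serve as counters and addresses and can only be added, subtracted (to `0` if the result would be
negative) and compared; real numbers can be added, subtracted, multiplied, divided and compared.
Each such operation, each access to an array and each evaluation of a test costs one unit of time.
A program refers to finitely many registers and arrays, fixed in advance. -/

/-- A configuration of the memory: registers, and arrays (indexed by the number of the array and
the position in it). -/
structure RAMState where
  natReg : ℕ → ℕ
  realReg : ℕ → ℝ
  natArr : ℕ → ℕ → ℕ
  realArr : ℕ → ℕ → ℝ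

/-- Tests compare the contents of two registers. -/
inductive RAMTest
  | natLt (a b : ℕ)
  | realLt (a b : ℕ)

/-- Programs. Except for the constants `c`, arguments are numbers of registers (`d`, `a`, `b`) or
of arrays (`m`). -/
inductive RAMProg
  | skip
  | natConst (d c : ℕ)
  | natAdd (d a b : ℕ)
  | natSub (d a b : ℕ)
  | natLoad (d m a : ℕ)
  | natStore (m a b : ℕ)
  | realConst (d : ℕ) (c : ℤ)
  | realAdd (d a b : ℕ)
  | realSub (d a b : ℕ)
  | realMul (d a b : ℕ)
  | realDiv (d a b : ℕ)
  | realLoad (d m a : ℕ)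
  | realStore (m a b : ℕ)
  | seq (p q : RAMProg)
  | ite (c : RAMTest) (p q : RAMProg)
  | while (c : RAMTest) (p : RAMProg)

namespace RAMState

def setNat (σ : RAMState) (d v : ℕ) : RAMState :=
  { σ with natReg := Function.update σ.natReg d v }

def setReal (σ : RAMState) (d : ℕ) (v : ℝ) : RAMState :=
  { σ with realReg := Function.update σ.realReg d v }

def setNatArr (σ : RAMState) (m k v : ℕ) : RAMState :=
  { σ with natArr := Function.update σ.natArr m (Function.update (σ.natArr m) k v) }

def setRealArr (σ : RAMState) (m k : ℕ) (v : ℝ) : RAMState :=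
  { σ with realArr := Function.update σ.realArr m (Function.update (σ.realArr m) k v) }

end RAMState

/-- The test succeeds. -/
def RAMTest.Holds : RAMTest → RAMState → Prop
  | natLt a b, σ => σ.natReg a < σ.natReg b
  | realLt a b, σ => σ.realReg a < σ.realReg b

/-- `RAMProg.Exec p σ t τ`: the program `p`, started in the configuration `σ`, halts after exactly
`t` units of time in the configuration `τ`. A division by zero never completes. -/
inductive RAMProg.Exec : RAMProg → RAMState → ℕ → RAMState → Prop
  | skip (σ) : Exec .skip σ 1 σ
  | natConst (σ d c) : Exec (.natConst d c) σ 1 (σ.setNat d c)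
  | natAdd (σ d a b) : Exec (.natAdd d a b) σ 1 (σ.setNat d (σ.natReg a + σ.natReg b))
  | natSub (σ d a b) : Exec (.natSub d a b) σ 1 (σ.setNat d (σ.natReg a - σ.natReg b))
  | natLoad (σ d m a) : Exec (.natLoad d m a) σ 1 (σ.setNat d (σ.natArr m (σ.natReg a)))
  | natStore (σ m a b) :
      Exec (.natStore m a b) σ 1 (σ.setNatArr m (σ.natReg a) (σ.natReg b))
  | realConst (σ d c) : Exec (.realConst d c) σ 1 (σ.setReal d (c : ℝ))
  | realAdd (σ d a b) : Exec (.realAdd d a b) σ 1 (σ.setReal d (σ.realReg a + σ.realReg b))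
  | realSub (σ d a b) : Exec (.realSub d a b) σ 1 (σ.setReal d (σ.realReg a - σ.realReg b))
  | realMul (σ d a b) : Exec (.realMul d a b) σ 1 (σ.setReal d (σ.realReg a * σ.realReg b))
  | realDiv (σ d a b) (h : σ.realReg b ≠ 0) :
      Exec (.realDiv d a b) σ 1 (σ.setReal d (σ.realReg a / σ.realReg b))
  | realLoad (σ d m a) : Exec (.realLoad d m a) σ 1 (σ.setReal d (σ.realArr m (σ.natReg a)))
  | realStore (σ m a b) :
      Exec (.realStore m a b) σ 1 (σ.setRealArr m (σ.natReg a) (σ.realReg b))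
  | seq {p q σ τ ρ s t} (hp : Exec p σ s τ) (hq : Exec q τ t ρ) :
      Exec (.seq p q) σ (s + t) ρ
  | ite_true {c p q σ τ t} (hc : c.Holds σ) (hp : Exec p σ t τ) :
      Exec (.ite c p q) σ (t + 1) τ
  | ite_false {c p q σ τ t} (hc : ¬ c.Holds σ) (hq : Exec q σ t τ) :
      Exec (.ite c p q) σ (t + 1) τ
  | while_true {c p σ τ ρ s t} (hc : c.Holds σ) (hp : Exec p σ s τ)
      (hw : Exec (.while c p) τ t ρ) : Exec (.while c p) σ (s + t + 1) ρ
  | while_false {c p σ} (hc : ¬ c.Holds σ) : Exec (.while c p) σ 1 σ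

/-- The initial configuration for a weighted graph on the vertices `0, …, n - 1` and a starting
vertex `i`: register `0` holds `n`, register `1` holds `i`, array `0` holds the weight `ω(k,l)` at
position `k * n + l`, and everything else is `0`. -/
def coverInput {n : ℕ} (G : WeightedGraph (Fin n)) (i : Fin n) : RAMState where
  natReg := fun r => if r = 0 then n else if r = 1 then (i : ℕ) else 0
  realReg := fun _ => 0
  natArr := fun _ _ => 0
  realArr := fun m a =>
    if m = 0 then ∑ k : Fin n, ∑ l : Fin n, if a = (k : ℕ) * n + l then G.weight k l else 0
    else 0

end

/-!
A visit to a new vertex `j` turns the state `(P, i)` into `(P ∪ {j}, j)`, and nothing happens in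
between except that the token moves inside `P`; hence the recursion. The exit probabilities
`p(P, ·, j)` satisfy Kirchhoff's law by conditioning on the first step, and by the maximum principle
they are the only potential with the given boundary values.

By conditioning on the first step, the function `φ i = h_{(P,i),f}` on `P`, extended to `j ∉ P` by
`h_{(P∪{j},j),f}`, is the potential when a current of size `ω(i)` is fed in at every `i ∈ P`. So for
every `P` the numbers `h_{(P∪{i},i),f}` solve a linear system with `n` unknowns, whose right-hand
side only involves larger sets. The maximum principle applies to every subset of `P` in the place of
`P`, which makes all leading principal submatrices of the system nonsingular. Gauss–Jordan
elimination can thus be done without pivoting, in `O(n³)` steps for each of the `2^n` sets. The sets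
are treated in the decreasing order of their binary numbers; the row of the table for the empty set
consists of the cover times.
-/

noncomputable section

/-! ### Path cylinders and the Markov property -/

section MarkovChain

variable {S : Type*}

/-- The cylinder set of the trajectories which follow the path `s` up to time `n`. These sets
determine a probability measure on trajectories, and the Markov chain gives them explicit
probabilities. -/
def pathCylinder (s : ℕ → S) (n : ℕ) : Set (ℕ → S) := {x | ∀ u ≤ n, x u = s u}

theorem mem_pathCylinder {s x : ℕ → S} {n : ℕ} : x ∈ pathCylinder s n ↔ ∀ u ≤ n, x u = s u :=
  Iff.rfl

theorem update_mem_pathCylinder_succ {s x : ℕ → S} {n : ℕ} {b : S} :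
    Function.update x (n + 1) b ∈ pathCylinder s (n + 1) ↔
      x ∈ pathCylinder s n ∧ b = s (n + 1) := by
  refine ⟨fun h => ⟨fun u hu => ?_, ?_⟩, fun ⟨hx, hb⟩ u hu => ?_⟩
  · simpa [show u ≠ n + 1 by omega] using h u (by omega)
  · simpa using h (n + 1) le_rfl
  · obtain rfl | hu := eq_or_lt_of_le hu
    · simpa using hb
    · simpa [hu.ne] using hx u (by omega)

variable [MeasurableSpace S]

theorem measurableSet_pathCylinder [MeasurableSingletonClass S] (s : ℕ → S) (n : ℕ) :
    MeasurableSet (pathCylinder s n) := by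
  have pathCylinder_eq : pathCylinder s n = ⋂ u, ⋂ (_ : u ≤ n), (fun x => x u) ⁻¹' {s u} := by
    ext x
    simp [pathCylinder]
  rw [pathCylinder_eq]
  exact .iInter fun u => .iInter fun _ => measurable_pi_apply u (measurableSet_singleton (s u))

/-- Measures on a product are determined by their finite-dimensional marginals, and those are
discrete here. -/
theorem measure_ext_of_pathCylinder [Countable S] [MeasurableSingletonClass S]
    {μ ν : Measure (ℕ → S)} [IsFiniteMeasure μ]
    (h : ∀ s n, μ (pathCylinder s n) = ν (pathCylinder s n)) : μ = ν := by
  have marginal_Iic (n : ℕ) : ν.map (Finset.Iic n).restrict = μ.map (Finset.Iic n).restrict := by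
    refine Measure.ext_of_singleton fun s => ?_
    let s' : ℕ → S := fun u => s ⟨min u n, Finset.mem_Iic.2 (min_le_right u n)⟩
    have preimage_singleton : (Finset.Iic n).restrict ⁻¹' ({s} : Set (Finset.Iic n → S)) =
        pathCylinder s' n := by
      ext x
      simp +contextual [funext_iff, pathCylinder, s']
    rw [Measure.map_apply (by fun_prop) (measurableSet_singleton s),
      Measure.map_apply (by fun_prop) (measurableSet_singleton s), preimage_singleton, h]
  refine IsProjectiveLimit.unique (P := fun I => μ.map I.restrict) (fun _ => rfl) fun I => ?_
  have hI : I ⊆ Finset.Iic (I.sup id) := fun i hi =>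
    Finset.mem_Iic.2 (Finset.le_sup (f := id) hi)
  have restrict_eq : (I.restrict : (ℕ → S) → I → S) =
      Finset.restrict₂ (π := fun _ => S) hI ∘ (Finset.Iic (I.sup id)).restrict := rfl
  dsimp only
  rw [restrict_eq, ← Measure.map_map (by fun_prop) (by fun_prop), marginal_Iic,
    Measure.map_map (by fun_prop) (by fun_prop)]

variable [Countable S] [MeasurableSingletonClass S]

instance (step : S → PMF S) (a : S) : IsProbabilityMeasure (chainLaw step a) :=
  inferInstanceAs (IsProbabilityMeasure (Kernel.traj (X := fun _ => S) (chainKernel step) 0 _))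

theorem lmarginalPartialTraj_indicator_pathCylinder_succ (step : S → PMF S) (s x : ℕ → S) (n : ℕ) :
    Kernel.lmarginalPartialTraj (X := fun _ => S) (chainKernel step) n (n + 1)
        ((pathCylinder s (n + 1)).indicator 1) x =
      step (s n) (s (n + 1)) * (pathCylinder s n).indicator 1 x := by
  classical
  rw [Kernel.lmarginalPartialTraj_succ _
    (measurable_one.indicator (measurableSet_pathCylinder s (n + 1)))]
  change ∫⁻ b, _ ∂(step (x n)).toMeasure = _
  by_cases hx : x ∈ pathCylinder s n
  · have indicator_update (b : S) : (pathCylinder s (n + 1)).indicator (1 : (ℕ → S) → ℝ≥0∞)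
        (Function.update x (n + 1) b) = Set.indicator {s (n + 1)} 1 b := by
      simp [Set.indicator_apply, update_mem_pathCylinder_succ, hx]
    simp only [indicator_update]
    rw [lintegral_indicator_one (measurableSet_singleton _),
      PMF.toMeasure_apply_singleton _ _ (measurableSet_singleton _), hx n le_rfl,
      Set.indicator_of_mem hx, Pi.one_apply, mul_one]
  · simp [update_mem_pathCylinder_succ, hx]

open scoped Classical in
theorem lmarginalPartialTraj_indicator_pathCylinder (step : S → PMF S) (s x : ℕ → S) (n : ℕ) :
    Kernel.lmarginalPartialTraj (X := fun _ => S) (chainKernel step) 0 n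
        ((pathCylinder s n).indicator 1) x =
      (if x 0 = s 0 then 1 else 0) * ∏ u ∈ Finset.range n, step (s u) (s (u + 1)) := by
  have hmeas (n : ℕ) : Measurable ((pathCylinder s n).indicator (1 : (ℕ → S) → ℝ≥0∞)) :=
    measurable_one.indicator (measurableSet_pathCylinder s n)
  induction n with
  | zero =>
    rw [Kernel.lmarginalPartialTraj_le _ le_rfl (hmeas 0)]
    simp [Set.indicator_apply, pathCylinder]
  | succ n ih =>
    rw [← Kernel.lmarginalPartialTraj_self (Nat.zero_le n) n.le_succ (hmeas (n + 1)),
      funext fun x => lmarginalPartialTraj_indicator_pathCylinder_succ step s x n,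
      Kernel.lmarginalPartialTraj,
      lintegral_const_mul _ (by exact (hmeas n).comp measurable_updateFinset)]
    rw [Kernel.lmarginalPartialTraj] at ih
    rw [ih, Finset.prod_range_succ, mul_left_comm, mul_comm (step (s n) (s (n + 1)))]

open scoped Classical in
theorem chainLaw_pathCylinder (step : S → PMF S) (a : S) (s : ℕ → S) (n : ℕ) :
    chainLaw step a (pathCylinder s n) =
      (if a = s 0 then 1 else 0) * ∏ u ∈ Finset.range n, step (s u) (s (u + 1)) := by
  have updateFinset_mem (x : ℕ → S) : Function.updateFinset (fun _ => a) (Finset.Iic n)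
      (Preorder.frestrictLe (π := fun _ : ℕ => S) n x) ∈ pathCylinder s n ↔
        x ∈ pathCylinder s n :=
    forall₂_congr fun u hu => by simp [Function.updateFinset, hu]
  have hmeas : Measurable fun z : Finset.Iic n → S =>
      (pathCylinder s n).indicator (1 : (ℕ → S) → ℝ≥0∞)
        (Function.updateFinset (fun _ => a) (Finset.Iic n) z) :=
    (measurable_one.indicator (measurableSet_pathCylinder s n)).comp measurable_updateFinset
  have restrict_const : Preorder.frestrictLe (π := fun _ : ℕ => S) 0 (fun _ => a) = fun _ => a :=
    rfl
  rw [← lmarginalPartialTraj_indicator_pathCylinder step s (fun _ => a) n,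
    Kernel.lmarginalPartialTraj, chainLaw, restrict_const, ← Kernel.traj_map_frestrictLe_apply,
    lintegral_map hmeas (by fun_prop),
    ← lintegral_indicator_one (measurableSet_pathCylinder s n)]
  simp only [Set.indicator_apply, updateFinset_mem, Pi.one_apply]

theorem chainLaw_ae_zero (step : S → PMF S) (a : S) : ∀ᵐ x ∂(chainLaw step a), x 0 = a := by
  classical
  have h := chainLaw_pathCylinder step a (fun _ => a) 0
  rw [if_pos rfl, Finset.prod_range_zero, mul_one] at h
  filter_upwards [(mem_ae_iff_prob_eq_one (measurableSet_pathCylinder _ 0)).2 h] with x hx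
  exact hx 0 le_rfl

/-- The trajectory which starts at `a` and goes on as `y`, for conditioning on the first step of
a chain started at `a`. -/
def consTraj {S : Type*} (a : S) (y : ℕ → S) : ℕ → S := fun t => Nat.casesOn t a y

omit [Countable S] [MeasurableSingletonClass S] in
theorem measurable_consTraj (a : S) : Measurable (consTraj a) := by
  refine measurable_pi_iff.2 fun t => ?_
  cases t with
  | zero => exact measurable_const
  | succ t => exact measurable_pi_apply t

omit [MeasurableSpace S] [Countable S] [MeasurableSingletonClass S] in
theorem consTraj_mem_pathCylinder_succ {a : S} {s y : ℕ → S} {n : ℕ} :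
    consTraj a y ∈ pathCylinder s (n + 1) ↔
      a = s 0 ∧ y ∈ pathCylinder (fun u => s (u + 1)) n := by
  refine ⟨fun h => ⟨h 0 (by omega), fun u hu => h (u + 1) (by omega)⟩, fun ⟨h₀, h⟩ u hu => ?_⟩
  cases u with
  | zero => exact h₀
  | succ u => exact h u (by omega)

theorem chainLaw_pathCylinder_eq_tsum (step : S → PMF S) (a : S) (s : ℕ → S) (n : ℕ) :
    chainLaw step a (pathCylinder s n) =
      ∑' b, step a b * chainLaw step b (consTraj a ⁻¹' pathCylinder s n) := by
  classical
  by_cases ha : a = s 0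
  · cases n with
    | zero =>
      have preimage_eq : consTraj a ⁻¹' pathCylinder s 0 = Set.univ := by
        ext y
        simp [mem_pathCylinder, consTraj, ha]
      simp only [preimage_eq, measure_univ, mul_one, PMF.tsum_coe]
      simp [chainLaw_pathCylinder, ha]
    | succ n =>
      have preimage_eq : consTraj a ⁻¹' pathCylinder s (n + 1) =
          pathCylinder (fun u => s (u + 1)) n := by
        ext y
        simp [consTraj_mem_pathCylinder_succ, ha]
      simp only [preimage_eq, chainLaw_pathCylinder]
      rw [tsum_eq_single (s 1) fun b hb => by simp [hb], Finset.prod_range_succ']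
      simp [ha, mul_comm]
  · have preimage_eq : consTraj a ⁻¹' pathCylinder s n = ∅ :=
      Set.eq_empty_of_forall_notMem fun y hy => ha (hy 0 (Nat.zero_le n))
    simp [preimage_eq, chainLaw_pathCylinder, ha]

theorem chainLaw_eq_sum (step : S → PMF S) (a : S) :
    chainLaw step a = Measure.sum fun b => step a b • (chainLaw step b).map (consTraj a) := by
  refine measure_ext_of_pathCylinder fun s n => ?_
  have hmeas := measurableSet_pathCylinder s n
  simp only [chainLaw_pathCylinder_eq_tsum step a s n, Measure.sum_apply _ hmeas,
    Measure.smul_apply, smul_eq_mul, Measure.map_apply (measurable_consTraj a) hmeas]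

theorem lintegral_chainLaw (step : S → PMF S) (a : S) {F : (ℕ → S) → ℝ≥0∞} (hF : Measurable F) :
    ∫⁻ x, F x ∂(chainLaw step a) =
      ∑' b, step a b * ∫⁻ y, F (consTraj a y) ∂(chainLaw step b) := by
  conv_lhs => rw [chainLaw_eq_sum]
  simp only [lintegral_sum_measure, lintegral_smul_measure,
    lintegral_map hF (measurable_consTraj a), smul_eq_mul]

theorem chainLaw_apply (step : S → PMF S) (a : S) {E : Set (ℕ → S)} (hE : MeasurableSet E) :
    chainLaw step a E = ∑' b, step a b * chainLaw step b (consTraj a ⁻¹' E) := by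
  conv_lhs => rw [chainLaw_eq_sum]
  simp only [Measure.sum_apply _ hE, Measure.smul_apply, smul_eq_mul,
    Measure.map_apply (measurable_consTraj a) hE]

end MarkovChain

/-! ### Hitting times -/

theorem firstTime_of_zero {E : ℕ → Prop} (h : E 0) : firstTime E = 0 :=
  le_antisymm ((iInf₂_le (f := fun (t : ℕ) (_ : E t) => (t : ℝ≥0∞)) 0 h).trans_eq Nat.cast_zero)
    bot_le

theorem firstTime_of_not_zero {E : ℕ → Prop} (h : ¬ E 0) :
    firstTime E = 1 + firstTime fun t => E (t + 1) := by
  unfold firstTime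
  refine le_antisymm ?_ (le_iInf₂ fun t ht => ?_)
  · rw [ENNReal.add_iInf]
    refine le_iInf fun t => ?_
    by_cases ht : E (t + 1)
    · exact (iInf₂_le (t + 1) ht).trans_eq (by simp [ht, add_comm])
    · simp [ht]
  · cases t with
    | zero => exact absurd ht h
    | succ t =>
      rw [Nat.cast_add, Nat.cast_one, add_comm]
      exact add_le_add_left (iInf₂_le (f := fun t (_ : E (t + 1)) => (t : ℝ≥0∞)) t ht) _

theorem min_firstTime_succ {E : ℕ → Prop} (h : ¬ E 0) (n : ℕ) :
    min (firstTime E) ((n + 1 : ℕ) : ℝ≥0∞) = 1 + min (firstTime fun t => E (t + 1)) n := by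
  rw [firstTime_of_not_zero h, Nat.cast_add, Nat.cast_one, add_comm (n : ℝ≥0∞),
    min_add_add_left]

theorem firstTime_eq_encard (E : ℕ → Prop) :
    firstTime E = (({t : ℕ | ∀ u ≤ t, ¬ E u}.encard : ℕ∞) : ℝ≥0∞) := by
  classical
  by_cases h : ∃ t, E t
  · have not_before {t : ℕ} (ht : t < Nat.find h) : ¬ E t := Nat.find_min h ht
    have firstTime_eq : firstTime E = (Nat.find h : ℝ≥0∞) := by
      refine le_antisymm (iInf₂_le _ (Nat.find_spec h)) (le_iInf₂ fun t ht => ?_)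
      exact_mod_cast Nat.find_min' h ht
    have set_eq : {t : ℕ | ∀ u ≤ t, ¬ E u} = (Finset.range (Nat.find h) : Set ℕ) := by
      ext t
      simp only [Set.mem_ofPred_eq, Finset.coe_range, Set.mem_Iio]
      refine ⟨fun ht => ?_, fun ht u hu => not_before (hu.trans_lt ht)⟩
      by_contra! hle
      exact ht _ hle (Nat.find_spec h)
    rw [firstTime_eq, set_eq, Set.encard_coe_eq_coe_finsetCard, Finset.card_range]
    rfl
  · push Not at h
    simp [firstTime, h]

theorem firstTime_notMem_eq {S : Type*} {P : Set S} {x : ℕ → S} (h₀ : x 0 ∈ P) :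
    firstTime (fun t => x t ∉ P) = 1 + (({t : ℕ | ∀ u ≤ t + 1, x u ∈ P}.encard : ℕ∞) : ℝ≥0∞) := by
  have set_eq : {t : ℕ | ∀ u ≤ t, ¬ x (u + 1) ∉ P} = {t | ∀ u ≤ t + 1, x u ∈ P} := by
    ext t
    refine ⟨fun h u hu => ?_, fun h u hu => not_not.2 (h (u + 1) (by omega))⟩
    cases u with
    | zero => exact h₀
    | succ u => exact not_not.1 (h u (by omega))
  rw [firstTime_of_not_zero (not_not.2 h₀), firstTime_eq_encard, set_eq]

theorem measurable_firstTime {Ω : Type*} [MeasurableSpace Ω] {E : Ω → ℕ → Prop}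
    (hE : ∀ t, MeasurableSet {x | E x t}) : Measurable fun x => firstTime (E x) := by
  classical
  have firstTime_eq : (fun x => firstTime (E x)) =
      fun x => ⨅ t : ℕ, if E x t then (t : ℝ≥0∞) else ⊤ := by
    funext x
    refine iInf_congr fun t => ?_
    by_cases h : E x t <;> simp [h]
  rw [firstTime_eq]
  exact .iInf fun t => .ite (hE t) measurable_const measurable_const

theorem lintegral_eq_iSup_lintegral_min {Ω : Type*} [MeasurableSpace Ω] {μ : Measure Ω}
    {F : Ω → ℝ≥0∞} (hF : Measurable F) :
    ∫⁻ x, F x ∂μ = ⨆ n : ℕ, ∫⁻ x, min (F x) n ∂μ := by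
  rw [← lintegral_iSup (fun n => hF.min measurable_const) fun m n hmn _ =>
    min_le_min le_rfl (Nat.cast_le.2 hmn)]
  refine lintegral_congr fun x => ?_
  rw [← inf_iSup_eq, ENNReal.iSup_natCast, inf_top_eq]

section MarkovChain

variable {S : Type*} [Countable S] [MeasurableSpace S] [MeasurableSingletonClass S]

theorem measurableSet_visit (A : Set S) (t : ℕ) : MeasurableSet {x : ℕ → S | x t ∈ A} :=
  measurableSet_preimage (measurable_pi_apply t) A.to_countable.measurableSet

variable (step : S → PMF S)

theorem lintegral_chainLaw_of_consTraj_eq_one_add {a : S} {F H : (ℕ → S) → ℝ≥0∞}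
    (hF : Measurable F) (h : ∀ y, F (consTraj a y) = 1 + H y) :
    ∫⁻ x, F x ∂(chainLaw step a) = 1 + ∑' b, step a b * ∫⁻ y, H y ∂(chainLaw step b) := by
  simp only [lintegral_chainLaw step a hF, h, lintegral_add_left measurable_const,
    lintegral_const, measure_univ, mul_one, mul_add, ENNReal.tsum_add, PMF.tsum_coe]

variable (A : Set S)

theorem hittingTime_of_mem {a : S} (ha : a ∈ A) : hittingTime step a A = 0 := by
  refine lintegral_eq_zero_of_ae_eq_zero ?_
  filter_upwards [chainLaw_ae_zero step a] with x hx
  exact firstTime_of_zero (hx ▸ ha)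

theorem hittingTime_of_notMem {a : S} (ha : a ∉ A) :
    hittingTime step a A = 1 + ∑' b, step a b * hittingTime step b A :=
  lintegral_chainLaw_of_consTraj_eq_one_add step (measurable_firstTime (measurableSet_visit A))
    fun _ => firstTime_of_not_zero ha

/-- The expected number of steps until the first visit to `A`, each trajectory being stopped at
time `n`. Unlike the hitting time itself, it is determined by the equations of first step
analysis. -/
def truncHittingTime (n : ℕ) (a : S) : ℝ≥0∞ :=
  ∫⁻ x, min (firstTime fun t => x t ∈ A) n ∂(chainLaw step a)

theorem iSup_truncHittingTime (a : S) :
    ⨆ n, truncHittingTime step A n a = hittingTime step a A :=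
  (lintegral_eq_iSup_lintegral_min (measurable_firstTime (measurableSet_visit A))).symm

theorem truncHittingTime_le_hittingTime (n : ℕ) (a : S) :
    truncHittingTime step A n a ≤ hittingTime step a A :=
  lintegral_mono fun _ => min_le_left _ _

theorem truncHittingTime_zero (a : S) : truncHittingTime step A 0 a = 0 := by
  simp [truncHittingTime]

theorem truncHittingTime_of_mem {a : S} (ha : a ∈ A) (n : ℕ) : truncHittingTime step A n a = 0 :=
  le_bot_iff.1 ((truncHittingTime_le_hittingTime step A n a).trans_eq
    (hittingTime_of_mem step A ha))

theorem truncHittingTime_succ {a : S} (ha : a ∉ A) (n : ℕ) :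
    truncHittingTime step A (n + 1) a = 1 + ∑' b, step a b * truncHittingTime step A n b :=
  lintegral_chainLaw_of_consTraj_eq_one_add step
    ((measurable_firstTime (measurableSet_visit A)).min measurable_const)
    fun _ => min_firstTime_succ ha n

theorem hittingTime_le_of_supersolution (g : S → ℝ≥0∞)
    (hg : ∀ a ∉ A, 1 + ∑' b, step a b * g b ≤ g a) (a : S) : hittingTime step a A ≤ g a := by
  rw [← iSup_truncHittingTime]
  refine iSup_le fun n => ?_
  induction n generalizing a with
  | zero => simp [truncHittingTime_zero]
  | succ n ih =>
    by_cases ha : a ∈ A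
    · simp [truncHittingTime_of_mem step A ha]
    · rw [truncHittingTime_succ step A ha]
      refine le_trans ?_ (hg a ha)
      gcongr with b
      exact ih b

end MarkovChain

theorem tsum_pmf_map_mul {α β : Type*} (p : PMF α) (f : α → β) (g : β → ℝ≥0∞) :
    ∑' b, (p.map f) b * g b = ∑' a, p a * g (f a) := by
  classical
  simp only [PMF.map_apply, ← ENNReal.tsum_mul_right]
  rw [ENNReal.tsum_comm]
  refine tsum_congr fun a => ?_
  rw [tsum_eq_single (f a) fun b hb => by simp [hb], if_pos rfl]

namespace WeightedGraph

/-! ### The cover time as a hitting time -/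

section CoverTime

variable {V : Type*}

/-- The vertices outside `P` have been visited by the trajectory `x` by time `t`. For a walk at
`i`, this is the event of reaching the state `f` from `(P, i)`. -/
def CoveredBy (P : Finset V) (x : ℕ → V) (t : ℕ) : Prop := ∀ v, v ∈ P ∨ ∃ u ≤ t, x u = v

theorem coveredBy_insert [DecidableEq V] {P : Finset V} {x : ℕ → V} {j : V} (h : x 0 = j) :
    CoveredBy (insert j P) x = CoveredBy P x := by
  funext t
  refine propext (forall_congr' fun v => ?_)
  rw [Finset.mem_insert]
  refine ⟨?_, Or.imp_left Or.inr⟩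
  rintro ((rfl | hv) | hv)
  exacts [.inr ⟨0, Nat.zero_le _, h⟩, .inl hv, .inr hv]

theorem coveredBy_consTraj_zero {P : Finset V} {i : V} (hi : i ∈ P) (y : ℕ → V) :
    CoveredBy P (consTraj i y) 0 ↔ ∀ v, v ∈ P := by
  refine forall_congr' fun v => or_iff_left_of_imp ?_
  rintro ⟨u, hu, rfl⟩
  obtain rfl := Nat.le_zero.1 hu
  exact hi

theorem coveredBy_consTraj_succ {P : Finset V} {i : V} (hi : i ∈ P) (y : ℕ → V) (t : ℕ) :
    CoveredBy P (consTraj i y) (t + 1) ↔ CoveredBy P y t := by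
  refine forall_congr' fun v => ⟨?_, ?_⟩
  · rintro (hv | ⟨_ | u, hu, rfl⟩)
    exacts [.inl hv, .inl hi, .inr ⟨u, by omega, rfl⟩]
  · rintro (hv | ⟨u, hu, hv⟩)
    exacts [.inl hv, .inr ⟨u + 1, by omega, hv⟩]

variable [MeasurableSpace V] [MeasurableSingletonClass V]

theorem measurableSet_coveredBy [Countable V] (P : Finset V) (t : ℕ) :
    MeasurableSet {x | CoveredBy P x t} := by
  have coveredBy_eq : {x : ℕ → V | CoveredBy P x t} =
      ⋂ v, ({_x | v ∈ P} ∪ ⋃ u, ⋃ (_ : u ≤ t), (fun x : ℕ → V => x u) ⁻¹' {v}) := by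
    ext x
    simp [CoveredBy]
  rw [coveredBy_eq]
  exact .iInter fun v => (MeasurableSet.const _).union <| .iUnion fun u => .iUnion fun _ =>
    measurable_pi_apply u (measurableSet_singleton _)

variable [Fintype V] [DecidableEq V] (G : WeightedGraph V)

omit [MeasurableSpace V] [MeasurableSingletonClass V] in
theorem tsum_assocStep_mul (P : Finset V) (i : V) (g : Finset V × V → ℝ≥0∞) :
    ∑' y, G.assocStep (P, i) y * g y = ∑ j, G.step i j * g (insert j P, j) := by
  rw [← tsum_fintype (L := .unconditional V), assocStep, tsum_pmf_map_mul]

theorem lintegral_min_firstTime_coveredBy (n : ℕ) (P : Finset V) {i : V} (hi : i ∈ P) :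
    ∫⁻ x, min (firstTime (CoveredBy P x)) n ∂(chainLaw G.step i) =
      truncHittingTime G.assocStep (covered V) n (P, i) := by
  induction n generalizing P i with
  | zero => simp [truncHittingTime_zero]
  | succ n ih =>
    by_cases hP : P = Finset.univ
    · have covered_at_start (x : ℕ → V) : CoveredBy P x 0 := fun v => .inl (hP ▸ Finset.mem_univ v)
      simp [truncHittingTime_of_mem _ _ (show (P, i) ∈ covered V from hP),
        firstTime_of_zero (covered_at_start _)]
    · have first_step (y : ℕ → V) :
          min (firstTime (CoveredBy P (consTraj i y))) ((n + 1 : ℕ) : ℝ≥0∞) =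
            1 + min (firstTime (CoveredBy P y)) n := by
        rw [min_firstTime_succ fun h =>
          hP (Finset.eq_univ_iff_forall.2 ((coveredBy_consTraj_zero hi y).1 h))]
        simp only [coveredBy_consTraj_succ hi]
      rw [truncHittingTime_succ _ _ (show (P, i) ∉ covered V from hP), tsum_assocStep_mul,
        lintegral_chainLaw_of_consTraj_eq_one_add _
          ((measurable_firstTime (measurableSet_coveredBy P)).min measurable_const) first_step,
        tsum_fintype]
      congr! 3 with j
      rw [← ih (insert j P) (Finset.mem_insert_self j P)]
      refine lintegral_congr_ae ?_
      filter_upwards [chainLaw_ae_zero G.step j] with x hx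
      rw [coveredBy_insert hx]

theorem coverTime_eq_hitCovered (i : V) : G.coverTime i = G.hitCovered {i} i := by
  have coverTime_eq : G.coverTime i = ∫⁻ x, firstTime (CoveredBy {i} x) ∂(chainLaw G.step i) := by
    refine lintegral_congr_ae ?_
    filter_upwards [chainLaw_ae_zero G.step i] with x hx
    rw [← insert_empty_eq, coveredBy_insert hx]
    refine congrArg firstTime (funext fun t => propext (forall_congr' fun v => ?_))
    rw [or_iff_right (Finset.notMem_empty v)]
  rw [coverTime_eq, lintegral_eq_iSup_lintegral_min
      (measurable_firstTime (measurableSet_coveredBy {i})),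
    hitCovered, ← iSup_truncHittingTime]
  exact iSup_congr fun n => G.lintegral_min_firstTime_coveredBy n {i} (Finset.mem_singleton_self i)

theorem hitCovered_univ (i : V) : G.hitCovered Finset.univ i = 0 :=
  hittingTime_of_mem _ _ rfl

theorem hitCovered_eq_one_add_sum {P : Finset V} (hP : P ≠ Finset.univ) (i : V) :
    G.hitCovered P i = 1 + ∑ j, G.step i j * G.hitCovered (insert j P) j := by
  rw [hitCovered, hittingTime_of_notMem _ _ (show (P, i) ∉ covered V from hP), tsum_assocStep_mul]
  rfl

end CoverTime

/-! ### Kirchhoff's laws -/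

section Laplacian

variable {V : Type*} (G : WeightedGraph V)

theorem weight_nonneg (i j : V) : 0 ≤ G.weight i j := by
  by_cases h : G.graph.Adj i j
  · exact (G.weight_pos i j h).le
  · exact (G.weight_eq_zero i j h).ge

variable [Fintype V]

/-- The weighted degree `ω(k) = ∑ l, ω(k,l)`. -/
def degree (k : V) : ℝ := ∑ l, G.weight k l

/-- The weighted graph Laplacian: its value at `k` is the net current out of the vertex `k` under
the potential `φ`. -/
def laplacian : (V → ℝ) →ₗ[ℝ] V → ℝ where
  toFun φ k := ∑ l, G.weight k l * (φ k - φ l)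
  map_add' φ ψ := by
    ext k
    simp only [Pi.add_apply, ← Finset.sum_add_distrib]
    exact Finset.sum_congr rfl fun l _ => by ring
  map_smul' c φ := by
    ext k
    simp only [Pi.smul_apply, smul_eq_mul, RingHom.id_apply, Finset.mul_sum]
    exact Finset.sum_congr rfl fun l _ => by ring

theorem laplacian_apply (φ : V → ℝ) (k : V) :
    G.laplacian φ k = ∑ l, G.weight k l * (φ k - φ l) := rfl

theorem laplacian_eq_degree_mul_sub (φ : V → ℝ) (k : V) :
    G.laplacian φ k = G.degree k * φ k - ∑ l, G.weight k l * φ l := by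
  simp only [laplacian_apply, degree, mul_sub, Finset.sum_sub_distrib, Finset.sum_mul]

theorem laplacian_eq_iff_eq_add_div {φ : V → ℝ} {k : V} (hk : 0 < G.degree k) (c : ℝ) :
    G.laplacian φ k = c * G.degree k ↔ φ k = c + (∑ l, G.weight k l * φ l) / G.degree k := by
  rw [laplacian_eq_degree_mul_sub, ← sub_eq_iff_eq_add', eq_div_iff hk.ne']
  constructor <;> intro h <;> linarith

variable {G}

theorem degree_pos (hG : G.graph.Connected) [Nontrivial V] (k : V) : 0 < G.degree k := by
  obtain ⟨l, hl⟩ := hG.preconnected.exists_adj_of_nontrivial k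
  exact Finset.sum_pos' (fun l _ => G.weight_nonneg k l)
    ⟨l, Finset.mem_univ l, G.weight_pos k l hl⟩

theorem degree_pos_of_mem (hG : G.graph.Connected) {P : Finset V} (hP : P ≠ Finset.univ) {k : V}
    (hk : k ∈ P) : 0 < G.degree k := by
  have : Nontrivial V := by
    by_contra h
    rw [not_nontrivial_iff_subsingleton] at h
    exact hP (Finset.eq_univ_iff_forall.2 fun v => Subsingleton.elim k v ▸ hk)
  exact degree_pos hG k

theorem eq_of_adj_of_isMinimum {φ : V → ℝ} {k l : V} (hmin : ∀ v, φ k ≤ φ v)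
    (hk : 0 ≤ G.laplacian φ k) (hkl : G.graph.Adj k l) : φ l = φ k := by
  have current_nonpos : ∀ v ∈ Finset.univ, G.weight k v * (φ k - φ v) ≤ 0 := fun v _ =>
    mul_nonpos_of_nonneg_of_nonpos (G.weight_nonneg k v) (sub_nonpos.2 (hmin v))
  have sum_current : ∑ v, G.weight k v * (φ k - φ v) = 0 :=
    le_antisymm (Finset.sum_nonpos current_nonpos) (G.laplacian_apply φ k ▸ hk)
  have current_zero := (Finset.sum_eq_zero_iff_of_nonpos current_nonpos).1 sum_current l
    (Finset.mem_univ l)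
  exact (sub_eq_zero.1 ((mul_eq_zero.1 current_zero).resolve_left
    (G.weight_pos k l hkl).ne')).symm

/-- The minimum principle: a negative minimum would propagate along the edges out of `P`. -/
theorem nonneg_of_laplacian_nonneg (hG : G.graph.Connected) {P : Finset V}
    (hP : P ≠ Finset.univ) {φ : V → ℝ} (hφ : ∀ k ∈ P, 0 ≤ G.laplacian φ k)
    (h₀ : ∀ k ∉ P, 0 ≤ φ k) (k : V) : 0 ≤ φ k := by
  by_contra! hk
  obtain ⟨m, -, hm⟩ := Finset.exists_min_image Finset.univ φ ⟨k, Finset.mem_univ k⟩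
  have hm_neg : φ m < 0 := (hm k (Finset.mem_univ k)).trans_lt hk
  obtain ⟨v, hv⟩ : ∃ v, v ∉ P := by
    by_contra! h
    exact hP (Finset.eq_univ_iff_forall.2 h)
  obtain ⟨w⟩ := hG.preconnected m v
  obtain ⟨⟨⟨a, b⟩, hab⟩, -, ha, hb⟩ := w.exists_boundary_dart {x | φ x = φ m} rfl
    (hm_neg.trans_le (h₀ v hv)).ne'
  have haP : a ∈ P := by
    by_contra haP
    exact (h₀ a haP).not_gt (ha.trans_lt hm_neg)
  exact hb ((eq_of_adj_of_isMinimum (fun x => ha.trans_le (hm x (Finset.mem_univ x)))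
    (hφ a haP) hab).trans ha)

theorem eq_zero_of_laplacian_eq_zero (hG : G.graph.Connected) {P : Finset V}
    (hP : P ≠ Finset.univ) {φ : V → ℝ} (hφ : ∀ k ∈ P, G.laplacian φ k = 0)
    (h₀ : ∀ k ∉ P, φ k = 0) : φ = 0 := by
  refine funext fun k => le_antisymm (neg_nonneg.1 ?_) ?_
  · refine nonneg_of_laplacian_nonneg hG hP (φ := -φ) (fun l hl => ?_) (fun l hl => ?_) k
    · simp [hφ l hl]
    · simp [h₀ l hl]
  · exact nonneg_of_laplacian_nonneg hG hP (fun l hl => (hφ l hl).ge) (fun l hl => (h₀ l hl).ge) k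

theorem eq_of_laplacian_eq (hG : G.graph.Connected) {P : Finset V} (hP : P ≠ Finset.univ)
    {φ ψ : V → ℝ} (h : ∀ k ∈ P, G.laplacian φ k = G.laplacian ψ k) (h₀ : ∀ k ∉ P, φ k = ψ k) :
    φ = ψ :=
  sub_eq_zero.1 <| eq_zero_of_laplacian_eq_zero hG hP
    (fun k hk => by rw [map_sub, Pi.sub_apply, h k hk, sub_self])
    (fun k hk => by rw [Pi.sub_apply, h₀ k hk, sub_self])

theorem exists_laplacian_eq (hG : G.graph.Connected) {P : Finset V} (hP : P ≠ Finset.univ)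
    (r : V → ℝ) : ∃ φ : V → ℝ, (∀ k ∈ P, G.laplacian φ k = r k) ∧ ∀ k ∉ P, φ k = 0 := by
  classical
  let L : (V → ℝ) →ₗ[ℝ] V → ℝ :=
    LinearMap.pi fun k =>
      if k ∈ P then (LinearMap.proj k : (V → ℝ) →ₗ[ℝ] ℝ) ∘ₗ G.laplacian else LinearMap.proj k
  have L_of_mem (φ : V → ℝ) {k : V} (hk : k ∈ P) : L φ k = G.laplacian φ k := by simp [L, hk]
  have L_of_notMem (φ : V → ℝ) {k : V} (hk : k ∉ P) : L φ k = φ k := by simp [L, hk]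
  have L_injective : Function.Injective L := by
    refine (injective_iff_map_eq_zero L).2 fun φ hφ => ?_
    refine eq_zero_of_laplacian_eq_zero hG hP (fun k hk => ?_) fun k hk => ?_
    · rw [← L_of_mem φ hk, hφ, Pi.zero_apply]
    · rw [← L_of_notMem φ hk, hφ, Pi.zero_apply]
  obtain ⟨φ, hφ⟩ := LinearMap.injective_iff_surjective.1 L_injective
    fun k => if k ∈ P then r k else 0
  refine ⟨φ, fun k hk => ?_, fun k hk => ?_⟩
  · exact (L_of_mem φ hk).symm.trans (by simp only [hφ, if_pos hk])
  · exact (L_of_notMem φ hk).symm.trans (by simp only [hφ, if_neg hk])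

theorem step_apply {k : V} (hk : 0 < G.degree k) (l : V) :
    G.step k l = ENNReal.ofReal (G.weight k l / G.degree k) := by
  have tsum_weight : ∑' j, ENNReal.ofReal (G.weight k j) = ENNReal.ofReal (G.degree k) := by
    rw [tsum_fintype, degree, ENNReal.ofReal_sum_of_nonneg fun l _ => G.weight_nonneg k l]
  have tsum_ne_zero : ∑' j, ENNReal.ofReal (G.weight k j) ≠ 0 := by
    rw [tsum_weight]
    exact (ENNReal.ofReal_pos.2 hk).ne'
  rw [step, dif_neg tsum_ne_zero, PMF.normalize_apply, tsum_weight, ENNReal.ofReal_div_of_pos hk,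
    div_eq_mul_inv]

theorem sum_step_mul_ofReal {φ : V → ℝ} (hφ : ∀ l, 0 ≤ φ l) {k : V} (hk : 0 < G.degree k) :
    ∑ l, G.step k l * ENNReal.ofReal (φ l) =
      ENNReal.ofReal ((∑ l, G.weight k l * φ l) / G.degree k) := by
  have prob_nonneg (l : V) : 0 ≤ G.weight k l / G.degree k :=
    div_nonneg (G.weight_nonneg k l) hk.le
  simp only [step_apply hk, ← ENNReal.ofReal_mul (prob_nonneg _), Finset.sum_div]
  rw [← ENNReal.ofReal_sum_of_nonneg fun l _ => mul_nonneg (prob_nonneg l) (hφ l)]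
  simp only [div_mul_eq_mul_div]

/-- An equation of first step analysis is Kirchhoff's current law, with a current of `c * ω(k)`
fed in at `k`. -/
theorem laplacian_toReal {u : V → ℝ≥0∞} {c : ℝ≥0∞} (hu : ∀ l, u l ≠ ∞) (hc : c ≠ ∞) {k : V}
    (hk : 0 < G.degree k) (h : u k = c + ∑ l, G.step k l * u l) :
    G.laplacian (fun l => (u l).toReal) k = c.toReal * G.degree k := by
  have sum_step : ∑ l, G.step k l * u l =
      ENNReal.ofReal ((∑ l, G.weight k l * (u l).toReal) / G.degree k) := by
    simp only [← sum_step_mul_ofReal (fun _ => ENNReal.toReal_nonneg) hk,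
      ENNReal.ofReal_toReal (hu _)]
  rw [laplacian_eq_iff_eq_add_div (φ := fun l => (u l).toReal) G hk, h, sum_step,
    ENNReal.toReal_add hc ENNReal.ofReal_ne_top, ENNReal.toReal_ofReal]
  exact div_nonneg (Finset.sum_nonneg fun l _ =>
    mul_nonneg (G.weight_nonneg k l) ENNReal.toReal_nonneg) hk.le

end Laplacian

/-! ### Leaving a set of vertices -/

section Exit

variable {V : Type*} [Fintype V] [MeasurableSpace V] [MeasurableSingletonClass V]
  {G : WeightedGraph V} {P : Finset V}

theorem hittingTime_ne_top (hG : G.graph.Connected) (hP : P ≠ Finset.univ) (i : V) :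
    hittingTime G.step i {v | v ∉ P} ≠ ∞ := by
  obtain ⟨φ, hφ, h₀⟩ := exists_laplacian_eq hG hP G.degree
  have φ_nonneg : ∀ k, 0 ≤ φ k := nonneg_of_laplacian_nonneg hG hP
    (fun k hk => (hφ k hk).symm ▸ (degree_pos_of_mem hG hP hk).le) (fun k hk => (h₀ k hk).ge)
  refine ne_top_of_le_ne_top (b := ENNReal.ofReal (φ i)) ENNReal.ofReal_ne_top
    (hittingTime_le_of_supersolution G.step _ (fun k => ENNReal.ofReal (φ k)) (fun k hk => ?_) i)
  have degree_k := degree_pos_of_mem hG hP (not_not.1 hk)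
  have harmonic := hφ k (not_not.1 hk)
  rw [← one_mul (G.degree k), laplacian_eq_iff_eq_add_div G degree_k] at harmonic
  rw [tsum_fintype, sum_step_mul_ofReal φ_nonneg degree_k, ← ENNReal.ofReal_one,
    ← ENNReal.ofReal_add zero_le_one (div_nonneg (Finset.sum_nonneg fun l _ =>
      mul_nonneg (G.weight_nonneg k l) (φ_nonneg l)) degree_k.le), ← harmonic]

theorem hittingTime_compl_eq_one_add_stayTime {i : V} (hi : i ∈ P) :
    hittingTime G.step i {v | v ∉ P} = 1 + G.stayTime P i := by
  have hittingTime_eq : hittingTime G.step i {v | v ∉ P} = ∫⁻ x,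
      1 + (({t : ℕ | ∀ u ≤ t + 1, x u ∈ P}.encard : ℕ∞) : ℝ≥0∞) ∂(chainLaw G.step i) := by
    refine lintegral_congr_ae ?_
    filter_upwards [chainLaw_ae_zero G.step i] with x hx
    exact firstTime_notMem_eq (P := (P : Set V)) (hx ▸ hi)
  rw [hittingTime_eq, lintegral_add_left measurable_const, lintegral_const, measure_univ, mul_one,
    stayTime]

omit [Fintype V] in
theorem measurableSet_exit [Countable V] (P : Finset V) (j : V) :
    MeasurableSet {x : ℕ → V | ∃ t, (∀ u < t, x u ∈ P) ∧ x t ∉ P ∧ x t = j} := by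
  have exit_eq : {x : ℕ → V | ∃ t, (∀ u < t, x u ∈ P) ∧ x t ∉ P ∧ x t = j} =
      ⋃ t, ((⋂ u, ⋂ (_ : u < t), {x | x u ∈ (P : Set V)}) ∩
        ({x | x t ∈ (Pᶜ : Set V)} ∩ {x | x t ∈ ({j} : Set V)})) := by
    ext x
    simp
  rw [exit_eq]
  exact .iUnion fun t => (MeasurableSet.iInter fun u => .iInter fun _ =>
    measurableSet_visit _ u).inter ((measurableSet_visit _ t).inter (measurableSet_visit _ t))

theorem exitProb_of_mem {k : V} (hk : k ∈ P) (j : V) :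
    G.exitProb P k j = ∑ l, G.step k l * G.exitProb P l j := by
  unfold exitProb
  rw [chainLaw_apply _ _ (measurableSet_exit P j), tsum_fintype]
  congr! 4 with l
  ext x
  constructor
  · rintro ⟨_ | t, hstay, hout, ht⟩
    · exact absurd hk hout
    · exact ⟨t, fun u hu => hstay (u + 1) (by omega), hout, ht⟩
  · rintro ⟨t, hstay, hout, ht⟩
    refine ⟨t + 1, fun u hu => ?_, hout, ht⟩
    cases u with
    | zero => exact hk
    | succ u => exact hstay u (by omega)

open scoped Classical in
theorem exitProb_of_notMem {k : V} (hk : k ∉ P) (j : V) :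
    G.exitProb P k j = if k = j then 1 else 0 := by
  have exit_iff : ∀ᵐ x ∂(chainLaw G.step k),
      x ∈ {x : ℕ → V | ∃ t, (∀ u < t, x u ∈ P) ∧ x t ∉ P ∧ x t = j} ↔ x ∈ {_x | k = j} := by
    filter_upwards [chainLaw_ae_zero G.step k] with x hx
    constructor
    · rintro ⟨_ | t, hstay, -, ht⟩
      · exact hx.symm.trans ht
      · exact absurd (hx ▸ hstay 0 t.succ_pos) hk
    · exact fun h => ⟨0, fun u hu => absurd hu u.not_lt_zero, hx.symm ▸ hk, hx.trans h⟩
  rw [exitProb, measure_congr (Filter.eventuallyEq_set.2 exit_iff)]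
  split_ifs with h <;> simp [h]

theorem exitProb_ne_top (k j : V) : G.exitProb P k j ≠ ∞ := measure_ne_top _ _

theorem laplacian_exitProb_eq_zero (hG : G.graph.Connected) (hP : P ≠ Finset.univ) {k : V}
    (hk : k ∈ P) (j : V) : G.laplacian (fun i => (G.exitProb P i j).toReal) k = 0 := by
  rw [laplacian_toReal (c := 0) (fun l => exitProb_ne_top l j) ENNReal.zero_ne_top
    (degree_pos_of_mem hG hP hk) (by rw [zero_add]; exact exitProb_of_mem hk j),
    ENNReal.toReal_zero, zero_mul]

theorem isPotential_iff (hG : G.graph.Connected) {j : V} (hj : j ∉ P) (φ : V → ℝ) :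
    G.IsPotential P j φ ↔ φ = fun i => (G.exitProb P i j).toReal := by
  have hP : P ≠ Finset.univ := fun h => hj (h ▸ Finset.mem_univ j)
  have exitProb_laplacian {k : V} (hk : k ∈ P) := laplacian_exitProb_eq_zero hG hP hk j
  constructor
  · rintro ⟨hφj, hφ_out, hφ_in⟩
    refine eq_of_laplacian_eq hG hP (fun k hk => ?_) fun k hk => ?_
    · rw [exitProb_laplacian hk, laplacian_apply, hφ_in k hk]
    · by_cases hkj : k = j
      · rw [exitProb_of_notMem hk, if_pos hkj, hkj, hφj, ENNReal.toReal_one]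
      · simp [exitProb_of_notMem hk, hkj, hφ_out k hk hkj]
  · rintro rfl
    refine ⟨by simp [exitProb_of_notMem hj], fun k hk hkj => by simp [exitProb_of_notMem hk, hkj],
      fun k hk => ?_⟩
    rw [← laplacian_apply G fun i => (G.exitProb P i j).toReal]
    exact exitProb_laplacian hk

end Exit

/-! ### The recursion for the hitting times of the covered states -/

section Recursion

variable {V : Type*} [Fintype V] [MeasurableSpace V] [MeasurableSingletonClass V] [DecidableEq V]
  {G : WeightedGraph V} {P : Finset V}

/-- The expected total cost of a walk from `k` which pays `1` for every step until it leaves `P`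
and then `c j` at the vertex `j` at which it has left `P`. -/
def exitCost (G : WeightedGraph V) (P : Finset V) (c : V → ℝ≥0∞) (k : V) : ℝ≥0∞ :=
  hittingTime G.step k {v | v ∉ P} + ∑ j ∈ Pᶜ, G.exitProb P k j * c j

theorem exitCost_of_mem (c : V → ℝ≥0∞) {k : V} (hk : k ∈ P) :
    G.exitCost P c k = 1 + ∑ l, G.step k l * G.exitCost P c l := by
  simp only [exitCost]
  rw [hittingTime_of_notMem G.step {v | v ∉ P} (a := k) (not_not.2 hk), tsum_fintype, add_assoc]
  simp only [mul_add, Finset.sum_add_distrib, exitProb_of_mem hk, Finset.sum_mul, Finset.mul_sum,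
    mul_assoc]
  rw [Finset.sum_comm]

theorem exitCost_of_notMem (c : V → ℝ≥0∞) {k : V} (hk : k ∉ P) : G.exitCost P c k = c k := by
  rw [exitCost, hittingTime_of_mem G.step {v | v ∉ P} (a := k) hk, zero_add,
    Finset.sum_eq_single_of_mem k (Finset.mem_compl.2 hk)]
  · simp [exitProb_of_notMem hk]
  · intro j _ hjk
    simp [exitProb_of_notMem hk, hjk.symm]

theorem exitCost_ne_top (hG : G.graph.Connected) (hP : P ≠ Finset.univ) {c : V → ℝ≥0∞}
    (hc : ∀ j ∉ P, c j ≠ ∞) (k : V) : G.exitCost P c k ≠ ∞ :=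
  ENNReal.add_ne_top.2 ⟨hittingTime_ne_top hG hP k, ENNReal.sum_ne_top.2 fun j hj =>
    ENNReal.mul_ne_top (exitProb_ne_top k j) (hc j (Finset.mem_compl.1 hj))⟩

theorem hitCovered_le_exitCost (hP : P ≠ Finset.univ) {k : V} (hk : k ∈ P) :
    G.hitCovered P k ≤ G.exitCost P (fun j => G.hitCovered (insert j P) j) k := by
  rw [hitCovered, ← iSup_truncHittingTime]
  refine iSup_le fun n => ?_
  induction n generalizing k with
  | zero => simp [truncHittingTime_zero]
  | succ n ih =>
    rw [truncHittingTime_succ _ _ (show (P, k) ∉ covered V from hP), tsum_assocStep_mul,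
      exitCost_of_mem _ hk]
    gcongr with l
    by_cases hl : l ∈ P
    · rw [Finset.insert_eq_of_mem hl]
      exact ih hl
    · rw [exitCost_of_notMem _ hl]
      exact truncHittingTime_le_hittingTime _ _ _ _

theorem hitCovered_ne_top (hG : G.graph.Connected) {k : V} (hk : k ∈ P) :
    G.hitCovered P k ≠ ∞ := by
  induction h : Pᶜ.card generalizing P k with
  | zero =>
    rw [Finset.card_eq_zero, Finset.compl_eq_empty_iff] at h
    rw [h, hitCovered_univ]
    exact ENNReal.zero_ne_top
  | succ m ih =>
    have hP : P ≠ Finset.univ := by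
      rintro rfl
      simp at h
    refine ne_top_of_le_ne_top (exitCost_ne_top hG hP (fun j hj => ?_) k)
      (hitCovered_le_exitCost hP hk)
    refine ih (Finset.mem_insert_self j P) ?_
    rw [Finset.compl_insert, Finset.card_erase_of_mem (Finset.mem_compl.2 hj), h, m.add_sub_cancel]

/-- Both sides satisfy the same equations of first step analysis in `P` and agree outside `P`. -/
theorem hitCovered_eq_exitCost (hG : G.graph.Connected) (hP : P ≠ Finset.univ) {k : V}
    (hk : k ∈ P) : G.hitCovered P k = G.exitCost P (fun j => G.hitCovered (insert j P) j) k := by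
  have hitCovered_fin (l : V) : G.hitCovered (insert l P) l ≠ ∞ :=
    hitCovered_ne_top hG (Finset.mem_insert_self l P)
  have exitCost_fin := exitCost_ne_top hG hP fun j _ => hitCovered_fin j
  have toReal_eq := eq_of_laplacian_eq hG hP (φ := fun l => (G.hitCovered (insert l P) l).toReal)
    (ψ := fun l => (G.exitCost P (fun j => G.hitCovered (insert j P) j) l).toReal)
    (fun l hl => ?_) fun l hl => by rw [exitCost_of_notMem _ hl]
  · rw [← ENNReal.toReal_eq_toReal_iff' (hitCovered_ne_top hG hk) (exitCost_fin k)]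
    simpa only [Finset.insert_eq_of_mem hk] using congrFun toReal_eq k
  · have degree_l := degree_pos_of_mem hG hP hl
    rw [laplacian_toReal hitCovered_fin ENNReal.one_ne_top degree_l
        (by rw [Finset.insert_eq_of_mem hl]; exact hitCovered_eq_one_add_sum G hP l),
      laplacian_toReal exitCost_fin ENNReal.one_ne_top degree_l (exitCost_of_mem _ hl)]

theorem hitCovered_recursion (hG : G.graph.Connected) (hP : P ≠ Finset.univ) {k : V}
    (hk : k ∈ P) : G.hitCovered P k = 1 + G.stayTime P k +
      ∑ j ∈ Pᶜ, G.exitProb P k j * G.hitCovered (insert j P) j := by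
  rw [hitCovered_eq_exitCost hG hP hk, exitCost, hittingTime_compl_eq_one_add_stayTime hk]

end Recursion

end WeightedGraph

/-! ### Gauss–Jordan elimination without pivoting -/

section Elimination

variable {K : Type*} [Field K]

/-- One step of the elimination: multiples of row `k` are subtracted from all other rows so that
column `k` becomes zero outside the diagonal. -/
def elimStep (k : ℕ) (M : ℕ → ℕ → K) (i l : ℕ) : K :=
  M i l - (if i = k then 0 else M i k / M k k) * M k l

/-- The matrix `M` after the elimination steps `0, …, k - 1`. -/
def elim (M : ℕ → ℕ → K) : ℕ → ℕ → ℕ → K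
  | 0 => M
  | k + 1 => elimStep k (elim M k)

theorem elimStep_pivot_row (k : ℕ) (M : ℕ → ℕ → K) (l : ℕ) : elimStep k M k l = M k l := by
  simp [elimStep]

theorem elimStep_congr {n k : ℕ} {M M' : ℕ → ℕ → K} (h : ∀ i < n, ∀ l ≤ n, M i l = M' i l)
    (hk : k < n) {i l : ℕ} (hi : i < n) (hl : l ≤ n) : elimStep k M i l = elimStep k M' i l := by
  simp only [elimStep, h i hi l hl, h i hi k hk.le, h k hk k hk.le, h k hk l hl]

variable {n : ℕ} {M : ℕ → ℕ → K}

theorem sum_elimStep (n k : ℕ) (M : ℕ → ℕ → K) (i : ℕ) (x : ℕ → K) :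
    ∑ l ∈ Finset.range n, elimStep k M i l * x l =
      (∑ l ∈ Finset.range n, M i l * x l) -
        (if i = k then 0 else M i k / M k k) * ∑ l ∈ Finset.range n, M k l * x l := by
  simp only [elimStep, sub_mul, Finset.sum_sub_distrib, Finset.mul_sum, mul_assoc]

theorem sum_elim_eq {x : ℕ → K} (hx : ∀ i < n, ∑ l ∈ Finset.range n, M i l * x l = M i n)
    {k : ℕ} (hk : k ≤ n) : ∀ i < n, ∑ l ∈ Finset.range n, elim M k i l * x l = elim M k i n := by
  induction k with
  | zero => exact hx
  | succ k ih =>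
    intro i hi
    rw [elim, sum_elimStep, ih (by omega) i hi, ih (by omega) k hk, elimStep]

theorem sum_eq_zero_of_sum_elim_eq_zero {k m : ℕ} (hkm : k ≤ m + 1) {x : ℕ → K}
    (hx : ∀ i ≤ m, ∑ l ∈ Finset.range n, elim M k i l * x l = 0) :
    ∀ i ≤ m, ∑ l ∈ Finset.range n, M i l * x l = 0 := by
  induction k with
  | zero => exact hx
  | succ k ih =>
    have pivot_row : ∑ l ∈ Finset.range n, elim M k k l * x l = 0 := by
      simpa only [elim, elimStep_pivot_row] using hx k (by omega)
    refine ih (by omega) fun i hi => ?_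
    simpa only [elim, sum_elimStep, pivot_row, mul_zero, sub_zero] using hx i hi

/-- The leading principal submatrices of `M`, up to size `n`, are nonsingular: a vector supported
on `{0, …, k}` which is annihilated by the rows `0, …, k` vanishes at `k`. -/
def LeadingRegular (n : ℕ) (M : ℕ → ℕ → K) : Prop :=
  ∀ k < n, ∀ x : ℕ → K, (∀ l, k < l → x l = 0) →
    (∀ i ≤ k, ∑ l ∈ Finset.range n, M i l * x l = 0) → x k = 0

/-- The shape of the matrix after `k` successful elimination steps: its first `k` columns are those
of an invertible diagonal matrix. -/
structure ColumnsDiagonal (k : ℕ) (M : ℕ → ℕ → K) : Prop where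
  off_diag : ∀ i l, l < k → i ≠ l → M i l = 0
  diag : ∀ l < k, M l l ≠ 0

theorem ColumnsDiagonal.elimStep {k : ℕ} (h : ColumnsDiagonal k M) (hk : M k k ≠ 0) :
    ColumnsDiagonal (k + 1) (elimStep k M) := by
  have column_lt (i : ℕ) {l : ℕ} (hl : l < k) : _root_.elimStep k M i l = M i l := by
    rw [_root_.elimStep, h.off_diag k l hl hl.ne', mul_zero, sub_zero]
  refine ⟨fun i l hl hil => ?_, fun l hl => ?_⟩
  · rcases Nat.lt_succ_iff_lt_or_eq.1 hl with hl | rfl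
    · rw [column_lt i hl, h.off_diag i l hl hil]
    · rw [_root_.elimStep, if_neg hil, div_mul_cancel₀ _ hk, sub_self]
  · rcases Nat.lt_succ_iff_lt_or_eq.1 hl with hl | rfl
    · rw [column_lt l hl]
      exact h.diag l hl
    · rwa [elimStep_pivot_row]

/-- If the pivot `k` vanished, then column `k` would be a combination of the columns before it,
as far as the rows `0, …, k` are concerned. -/
theorem ColumnsDiagonal.exists_sum_eq_zero {k : ℕ} (h : ColumnsDiagonal k M) (hk : k < n)
    (h₀ : M k k = 0) : ∃ x : ℕ → K, x k = 1 ∧ (∀ l, k < l → x l = 0) ∧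
      ∀ i ≤ k, ∑ l ∈ Finset.range n, M i l * x l = 0 := by
  let x : ℕ → K := fun l => if l < k then - M l k / M l l else if l = k then 1 else 0
  have x_pivot : x k = 1 := by simp [x]
  have x_gt (l : ℕ) (hl : k < l) : x l = 0 := by simp [x, hl.not_gt, hl.ne']
  refine ⟨x, x_pivot, x_gt, fun i hi => ?_⟩
  rcases Nat.lt_or_eq_of_le hi with hi | rfl
  · rw [Finset.sum_eq_add_of_mem i k (Finset.mem_range.2 (by omega)) (Finset.mem_range.2 hk) hi.ne,
      x_pivot, show x i = - M i k / M i i by simp [x, hi], mul_div_cancel₀ _ (h.diag i hi), mul_one,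
      neg_add_cancel]
    rintro l - ⟨hli, hlk⟩
    rcases lt_or_gt_of_ne hlk with hl | hl
    · rw [h.off_diag i l hl hli.symm, zero_mul]
    · rw [x_gt l hl, mul_zero]
  · refine Finset.sum_eq_zero fun l _ => ?_
    rcases lt_trichotomy l i with hl | rfl | hl
    · rw [h.off_diag i l hl hl.ne', zero_mul]
    · rw [h₀, zero_mul]
    · rw [x_gt l hl, mul_zero]

namespace LeadingRegular

theorem pivot_ne_zero_of_columnsDiagonal (hM : LeadingRegular n M) {k : ℕ} (hk : k < n)
    (h : ColumnsDiagonal k (elim M k)) : elim M k k k ≠ 0 := by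
  intro h₀
  obtain ⟨x, x_pivot, x_gt, hx⟩ := h.exists_sum_eq_zero hk h₀
  exact one_ne_zero (x_pivot.symm.trans
    (hM k hk x x_gt (sum_eq_zero_of_sum_elim_eq_zero (by omega) hx)))

theorem columnsDiagonal (hM : LeadingRegular n M) {k : ℕ} (hk : k ≤ n) :
    ColumnsDiagonal k (elim M k) := by
  induction k with
  | zero => exact ⟨by simp, by simp⟩
  | succ k ih =>
    have h := ih (by omega)
    exact h.elimStep (hM.pivot_ne_zero_of_columnsDiagonal hk h)

theorem pivot_ne_zero (hM : LeadingRegular n M) {k : ℕ} (hk : k < n) : elim M k k k ≠ 0 :=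
  hM.pivot_ne_zero_of_columnsDiagonal hk (hM.columnsDiagonal hk.le)

theorem diag_ne_zero (hM : LeadingRegular n M) {k : ℕ} (hk : k < n) : elim M n k k ≠ 0 :=
  (hM.columnsDiagonal le_rfl).diag k hk

theorem elim_div_elim_eq (hM : LeadingRegular n M) {x : ℕ → K}
    (hx : ∀ i < n, ∑ l ∈ Finset.range n, M i l * x l = M i n) {i : ℕ} (hi : i < n) :
    elim M n i n / elim M n i i = x i := by
  have row_eq := sum_elim_eq hx le_rfl i hi
  rw [Finset.sum_eq_single_of_mem i (Finset.mem_range.2 hi) fun l hl hli => by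
    rw [(hM.columnsDiagonal le_rfl).off_diag i l (Finset.mem_range.1 hl) hli.symm,
      zero_mul]] at row_eq
  rw [← row_eq, mul_div_cancel_left₀ _ (hM.diag_ne_zero hi)]

end LeadingRegular

end Elimination

/-! ### Sets of vertices as binary numbers -/

section Bits

theorem testBit_add_two_pow {P j : ℕ} (h : P.testBit j = false) (i : ℕ) :
    (P + 2 ^ j).testBit i = (decide (i = j) || P.testBit i) := by
  have hj : j ∉ Finset.equivBitIndices P := by simp [h]
  have insert_eq : Finset.equivBitIndices (P + 2 ^ j) = insert j (Finset.equivBitIndices P) := by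
    rw [← Equiv.eq_symm_apply, Finset.equivBitIndices_symm_apply, Finset.sum_insert hj, add_comm,
      ← Finset.equivBitIndices_symm_apply, Equiv.symm_apply_apply]
  rw [Bool.eq_iff_iff, Bool.or_eq_true, decide_eq_true_iff]
  simpa only [Finset.equivBitIndices_apply, List.mem_toFinset, Nat.mem_bitIndices,
    Finset.mem_insert] using Finset.ext_iff.1 insert_eq i

theorem add_two_pow_lt {n P i : ℕ} (hP : P < 2 ^ n) (hi : i < n) (h : P.testBit i = false) :
    P + 2 ^ i < 2 ^ n := by
  refine Nat.lt_pow_two_of_testBit _ fun j hj => ?_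
  rw [testBit_add_two_pow h, Nat.testBit_lt_two_pow
    (hP.trans_le (Nat.pow_le_pow_right (by norm_num) hj)), decide_eq_false (by omega),
    Bool.or_false]

theorem testBit_eq_false_iff_mod_lt (P i : ℕ) :
    P.testBit i = false ↔ P % 2 ^ (i + 1) < 2 ^ i := by
  have := Nat.mod_lt P (show 2 ^ i > 0 by positivity)
  rw [Nat.mod_pow_succ, ← Nat.toNat_testBit]
  cases P.testBit i
  · simp only [Bool.toNat_false, mul_zero, add_zero, this]
  · simp

theorem mod_two_pow_succ_sub (P i : ℕ) (h : P.testBit i = true) :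
    P % 2 ^ (i + 1) - 2 ^ i = P % 2 ^ i := by
  rw [Nat.mod_pow_succ, ← Nat.toNat_testBit, h]
  simp

theorem mod_two_pow_succ_of_testBit_eq_false {P i : ℕ} (h : P.testBit i = false) :
    P % 2 ^ (i + 1) = P % 2 ^ i := by
  rw [Nat.mod_pow_succ, ← Nat.toNat_testBit, h]
  simp

/-- The set of the positions, among the first `n`, of the ones in the binary expansion of `P`. -/
def bitFinset (n P : ℕ) : Finset (Fin n) := Finset.univ.filter fun i => P.testBit i

variable {n P : ℕ}

theorem mem_bitFinset {i : Fin n} : i ∈ bitFinset n P ↔ P.testBit i = true := by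
  simp [bitFinset]

theorem notMem_bitFinset {i : Fin n} : i ∉ bitFinset n P ↔ P.testBit i = false := by
  rw [mem_bitFinset, Bool.not_eq_true]

theorem bitFinset_add_two_pow {j : Fin n} (h : j ∉ bitFinset n P) :
    bitFinset n (P + 2 ^ (j : ℕ)) = insert j (bitFinset n P) := by
  ext i
  simp [mem_bitFinset, testBit_add_two_pow (notMem_bitFinset.1 h), Fin.ext_iff]

theorem bitFinset_zero (n : ℕ) : bitFinset n 0 = ∅ := by
  simp [bitFinset]

theorem bitFinset_two_pow_sub_one (n : ℕ) : bitFinset n (2 ^ n - 1) = Finset.univ := by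
  simp [bitFinset]

theorem bitFinset_ne_univ (h : P < 2 ^ n - 1) : bitFinset n P ≠ Finset.univ := by
  intro hP
  refine h.ne (Nat.eq_of_testBit_eq fun i => ?_)
  rw [Nat.testBit_two_pow_sub_one]
  by_cases hi : i < n
  · rw [decide_eq_true hi]
    exact (mem_bitFinset (i := ⟨i, hi⟩)).1 (hP ▸ Finset.mem_univ _)
  · rw [decide_eq_false hi]
    exact Nat.testBit_lt_two_pow
      ((show P < 2 ^ n by omega).trans_le (Nat.pow_le_pow_right (by norm_num) (by omega)))

end Bits

/-! ### The linear systems for the hitting times -/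

section System

/-- The augmented matrix, for weights `W`, of the linear system for a function on `{0, …, n - 1}`
which feeds in a current of `ω(i)` at the vertices `i` of the set with binary number `P` and has the
values `T` outside this set. -/
def systemMatrix (n : ℕ) (W : ℕ → ℕ → ℝ) (P : ℕ) (T : ℕ → ℝ) (i l : ℕ) : ℝ :=
  if P.testBit i then
    if l = n then ∑ m ∈ Finset.range n, W i m
    else (if l = i then ∑ m ∈ Finset.range n, W i m else 0) - W i l
  else if l = n then T i else if l = i then 1 else 0

variable {n : ℕ} (G : WeightedGraph (Fin n))

/-- The weights of a graph on `{0, …, n - 1}` as a function on all pairs of natural numbers. -/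
def natWeight (k l : ℕ) : ℝ :=
  if h : k < n ∧ l < n then G.weight ⟨k, h.1⟩ ⟨l, h.2⟩ else 0

theorem natWeight_val (k l : Fin n) : natWeight G k l = G.weight k l := by
  simp [natWeight]

theorem sum_natWeight (k : Fin n) : ∑ m ∈ Finset.range n, natWeight G k m = G.degree k := by
  simp only [Finset.sum_range, natWeight_val, WeightedGraph.degree]

theorem sum_systemMatrix (P : ℕ) (T x : ℕ → ℝ) (i : Fin n) :
    ∑ l ∈ Finset.range n, systemMatrix n (natWeight G) P T i l * x l =
      if i ∈ bitFinset n P then G.laplacian (fun k => x k) i else x i := by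
  have val_ne (l : Fin n) : (l : ℕ) ≠ n := l.2.ne
  rw [Finset.sum_range]
  by_cases h : P.testBit i
  · simp [systemMatrix, h, val_ne, sum_natWeight, natWeight_val, mem_bitFinset, Fin.val_inj,
      G.laplacian_eq_degree_mul_sub, sub_mul]
  · simp [systemMatrix, h, val_ne, mem_bitFinset, Fin.val_inj]

theorem systemMatrix_last_column (P : ℕ) (T : ℕ → ℝ) (i : Fin n) :
    systemMatrix n (natWeight G) P T i n = if i ∈ bitFinset n P then G.degree i else T i := by
  simp [systemMatrix, mem_bitFinset, sum_natWeight]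

variable {G} {P : ℕ}

theorem leadingRegular_systemMatrix (hG : G.graph.Connected) (hP : P < 2 ^ n - 1) (T : ℕ → ℝ) :
    LeadingRegular n (systemMatrix n (natWeight G) P T) := by
  intro k hk x hx hrow
  have leading_ne_univ : (bitFinset n P).filter (fun i : Fin n => (i : ℕ) ≤ k) ≠ Finset.univ :=
    fun h => bitFinset_ne_univ hP
      (Finset.eq_univ_iff_forall.2 fun i => (Finset.mem_filter.1 (h ▸ Finset.mem_univ i)).1)
  refine congrFun (WeightedGraph.eq_zero_of_laplacian_eq_zero hG leading_ne_univ
    (φ := fun i => x i) (fun i hi => ?_) fun i hi => ?_) ⟨k, hk⟩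
  · obtain ⟨hiP, hik⟩ := Finset.mem_filter.1 hi
    simpa only [sum_systemMatrix, if_pos hiP] using hrow i hik
  · rcases le_or_gt (i : ℕ) k with hik | hik
    · have hiP : i ∉ bitFinset n P := fun h => hi (Finset.mem_filter.2 ⟨h, hik⟩)
      simpa only [sum_systemMatrix, if_neg hiP] using hrow i hik
    · exact hx i hik

variable (G) in
/-- The value `h_{(P ∪ {k}, k), f}` for the set `P` with binary number `P` and `k < n`. -/
def coverValue (P k : ℕ) : ℝ :=
  if h : k < n then (G.hitCovered (insert ⟨k, h⟩ (bitFinset n P)) ⟨k, h⟩).toReal else 0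

theorem coverValue_val (P : ℕ) (k : Fin n) :
    coverValue G P k = (G.hitCovered (insert k (bitFinset n P)) k).toReal := by
  simp [coverValue]

theorem coverValue_add_two_pow {i : Fin n} (hi : i ∉ bitFinset n P) :
    coverValue G (P + 2 ^ (i : ℕ)) i = coverValue G P i := by
  rw [coverValue_val, coverValue_val, bitFinset_add_two_pow hi, Finset.insert_idem]

theorem laplacian_coverValue (hG : G.graph.Connected) (hP : P < 2 ^ n - 1) {i : Fin n}
    (hi : i ∈ bitFinset n P) :
    G.laplacian (fun k : Fin n => coverValue G P k) i = G.degree i := by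
  simp only [coverValue_val]
  rw [WeightedGraph.laplacian_toReal
    (fun l => WeightedGraph.hitCovered_ne_top hG (Finset.mem_insert_self l _)) ENNReal.one_ne_top
    (WeightedGraph.degree_pos_of_mem hG (bitFinset_ne_univ hP) hi), ENNReal.toReal_one, one_mul]
  rw [Finset.insert_eq_of_mem hi]
  exact WeightedGraph.hitCovered_eq_one_add_sum G (bitFinset_ne_univ hP) i

theorem elim_systemMatrix_eq_coverValue (hG : G.graph.Connected) (hP : P < 2 ^ n - 1) {T : ℕ → ℝ}
    (hT : ∀ i < n, P.testBit i = false → T i = coverValue G (P + 2 ^ i) i) {i : ℕ} (hi : i < n) :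
    elim (systemMatrix n (natWeight G) P T) n i n / elim (systemMatrix n (natWeight G) P T) n i i =
      coverValue G P i := by
  refine (leadingRegular_systemMatrix hG hP T).elim_div_elim_eq (fun i hi => ?_) hi
  lift i to Fin n using hi
  rw [sum_systemMatrix, systemMatrix_last_column]
  split_ifs with hiP
  · exact laplacian_coverValue hG hP hiP
  · rw [hT i i.2 (notMem_bitFinset.1 hiP), coverValue_add_two_pow hiP]

theorem coverValue_two_pow_sub_one (k : ℕ) : coverValue G (2 ^ n - 1) k = 0 := by
  simp [coverValue, bitFinset_two_pow_sub_one, WeightedGraph.hitCovered_univ]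

theorem coverValue_zero (i : Fin n) : coverValue G 0 i = (G.coverTime i).toReal := by
  simp [coverValue_val, bitFinset_zero, WeightedGraph.coverTime_eq_hitCovered]

end System

/-! ### Running times and effects of programs -/

infixr:60 " ⨟ " => RAMProg.seq

attribute [local simp] RAMState.setNat RAMState.setReal RAMState.setNatArr RAMState.setRealArr

/-- A register or an array of the machine. -/
inductive RAMCell
  | natReg (r : ℕ)
  | realReg (r : ℕ)
  | natArr (m : ℕ)
  | realArr (m : ℕ)
  deriving DecidableEq

namespace RAMCell

/-- The register or array has the same contents in both states. -/
def Agree : RAMCell → RAMState → RAMState → Prop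
  | natReg r, σ, τ => τ.natReg r = σ.natReg r
  | realReg r, σ, τ => τ.realReg r = σ.realReg r
  | natArr m, σ, τ => τ.natArr m = σ.natArr m
  | realArr m, σ, τ => τ.realArr m = σ.realArr m

theorem agree_refl (x : RAMCell) (σ : RAMState) : x.Agree σ σ := by
  cases x <;> rfl

theorem Agree.trans {x : RAMCell} {σ τ ρ : RAMState} (h₁ : x.Agree σ τ) (h₂ : x.Agree τ ρ) :
    x.Agree σ ρ := by
  cases x <;> exact Eq.trans h₂ h₁

end RAMCell

namespace RAMProg

/-- Started in `σ`, the program `p` halts after at most `T` steps, in a state with property `Q`. -/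
def Runs (p : RAMProg) (σ : RAMState) (T : ℕ) (Q : RAMState → Prop) : Prop :=
  ∃ t τ, Exec p σ t τ ∧ t ≤ T ∧ Q τ

/-- The effect of a program without loops; a division by zero is carried out, and a loop is
skipped. -/
def run : RAMProg → RAMState → RAMState
  | skip, σ => σ
  | natConst d c, σ => σ.setNat d c
  | natAdd d a b, σ => σ.setNat d (σ.natReg a + σ.natReg b)
  | natSub d a b, σ => σ.setNat d (σ.natReg a - σ.natReg b)
  | natLoad d m a, σ => σ.setNat d (σ.natArr m (σ.natReg a))
  | natStore m a b, σ => σ.setNatArr m (σ.natReg a) (σ.natReg b)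
  | realConst d c, σ => σ.setReal d c
  | realAdd d a b, σ => σ.setReal d (σ.realReg a + σ.realReg b)
  | realSub d a b, σ => σ.setReal d (σ.realReg a - σ.realReg b)
  | realMul d a b, σ => σ.setReal d (σ.realReg a * σ.realReg b)
  | realDiv d a b, σ => σ.setReal d (σ.realReg a / σ.realReg b)
  | realLoad d m a, σ => σ.setReal d (σ.realArr m (σ.natReg a))
  | realStore m a b, σ => σ.setRealArr m (σ.natReg a) (σ.realReg b)
  | seq p q, σ => q.run (p.run σ)
  | ite c p q, σ => open Classical in if c.Holds σ then p.run σ else q.run σ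
  | .while _ _, σ => σ

/-- Started in `σ`, the program meets neither a loop nor a division by zero. -/
def Safe : RAMProg → RAMState → Prop
  | realDiv _ _ b, σ => σ.realReg b ≠ 0
  | seq p q, σ => p.Safe σ ∧ q.Safe (p.run σ)
  | ite c p q, σ => (c.Holds σ → p.Safe σ) ∧ (¬ c.Holds σ → q.Safe σ)
  | .while _ _, _ => False
  | _, _ => True

/-- The largest number of steps taken by a program without loops. -/
def cost : RAMProg → ℕ
  | seq p q => p.cost + q.cost
  | ite _ p q => max p.cost q.cost + 1
  | .while _ _ => 0
  | _ => 1

/-- The registers and arrays which a program may write to. -/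
def targets : RAMProg → List RAMCell
  | skip => []
  | natConst d _ | natAdd d _ _ | natSub d _ _ | natLoad d _ _ => [.natReg d]
  | realConst d _ | realAdd d _ _ | realSub d _ _ | realMul d _ _ | realDiv d _ _
  | realLoad d _ _ => [.realReg d]
  | natStore m _ _ => [.natArr m]
  | realStore m _ _ => [.realArr m]
  | seq p q | ite _ p q => p.targets ++ q.targets
  | .while _ p => p.targets

/-- The states `σ` and `τ` differ at most in the registers and arrays which `p` may write to. -/
def Frame (p : RAMProg) (σ τ : RAMState) : Prop := ∀ x ∉ p.targets, x.Agree σ τ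

variable {p q : RAMProg} {σ τ ρ : RAMState} {s t T : ℕ} {Q R : RAMState → Prop}

namespace Frame

theorem refl (p : RAMProg) (σ : RAMState) : p.Frame σ σ := fun x _ => x.agree_refl σ

theorem trans (h₁ : p.Frame σ τ) (h₂ : p.Frame τ ρ) : p.Frame σ ρ :=
  fun x hx => (h₁ x hx).trans (h₂ x hx)

theorem mono (h : p.Frame σ τ) (hpq : p.targets ⊆ q.targets) : q.Frame σ τ :=
  fun x hx => h x fun hp => hx (hpq hp)

theorem natReg (h : p.Frame σ τ) {r : ℕ} (hr : .natReg r ∉ p.targets) :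
    τ.natReg r = σ.natReg r :=
  h _ hr

theorem realReg (h : p.Frame σ τ) {r : ℕ} (hr : .realReg r ∉ p.targets) :
    τ.realReg r = σ.realReg r :=
  h _ hr

theorem natArr (h : p.Frame σ τ) {m : ℕ} (hm : .natArr m ∉ p.targets) :
    τ.natArr m = σ.natArr m :=
  h _ hm

theorem realArr (h : p.Frame σ τ) {m : ℕ} (hm : .realArr m ∉ p.targets) :
    τ.realArr m = σ.realArr m :=
  h _ hm

end Frame

theorem Exec.frame (h : Exec p σ t τ) : p.Frame σ τ := by
  induction h with
  | seq _ _ hp hq => exact (hp.mono (by simp [targets])).trans (hq.mono (by simp [targets]))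
  | ite_true _ _ hp => exact hp.mono (by simp [targets])
  | ite_false _ _ hq => exact hq.mono (by simp [targets])
  | while_true _ _ _ hp hw => exact (hp.mono (by simp [targets])).trans hw
  | while_false | skip => exact .refl _ _
  | _ => rintro (r | r | m | m) <;> simp +contextual [targets, RAMCell.Agree]

theorem exec_run (h : p.Safe σ) : ∃ t ≤ p.cost, Exec p σ t (p.run σ) := by
  induction p generalizing σ with
  | seq p q hp hq =>
    obtain ⟨s, hs, hp⟩ := hp h.1
    obtain ⟨t, ht, hq⟩ := hq h.2
    exact ⟨s + t, Nat.add_le_add hs ht, .seq hp hq⟩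
  | ite c p q hp hq =>
    by_cases hc : c.Holds σ
    · obtain ⟨s, hs, hp⟩ := hp (h.1 hc)
      exact ⟨s + 1, by simp only [cost]; omega,
        by simpa only [run, if_pos hc] using .ite_true hc hp⟩
    · obtain ⟨t, ht, hq⟩ := hq (h.2 hc)
      exact ⟨t + 1, by simp only [cost]; omega,
        by simpa only [run, if_neg hc] using .ite_false hc hq⟩
  | realDiv d a b => exact ⟨1, le_rfl, .realDiv _ _ _ _ h⟩
  | _ => first | exact ⟨1, le_rfl, by constructor⟩ | exact h.elim

namespace Runs

theorem mono (h : p.Runs σ t Q) (ht : t ≤ T) (hQ : ∀ τ, Q τ → R τ) : p.Runs σ T R := by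
  obtain ⟨t', τ, h₁, h₂, h₃⟩ := h
  exact ⟨t', τ, h₁, h₂.trans ht, hQ τ h₃⟩

theorem le (h : p.Runs σ t Q) (ht : t ≤ T) : p.Runs σ T Q := h.mono ht fun _ => id

theorem frame (h : p.Runs σ t Q) : p.Runs σ t fun τ => p.Frame σ τ ∧ Q τ := by
  obtain ⟨t', τ, h₁, h₂, h₃⟩ := h
  exact ⟨t', τ, h₁, h₂, h₁.frame, h₃⟩

theorem of_safe (h : p.Safe σ) (hQ : Q (p.run σ)) : p.Runs σ p.cost Q := by
  obtain ⟨t, ht, h⟩ := exec_run h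
  exact ⟨t, _, h, ht, hQ⟩

theorem seq (hp : p.Runs σ s R) (hq : ∀ τ, p.Frame σ τ → R τ → q.Runs τ t Q) :
    (p ⨟ q).Runs σ (s + t) Q := by
  obtain ⟨t₁, τ, h₁, ht₁, hR⟩ := hp
  obtain ⟨t₂, ρ, h₂, ht₂, hQ⟩ := hq τ h₁.frame hR
  exact ⟨t₁ + t₂, ρ, .seq h₁ h₂, Nat.add_le_add ht₁ ht₂, hQ⟩

theorem ite {c : RAMTest} (hp : c.Holds σ → p.Runs σ t Q) (hq : ¬ c.Holds σ → q.Runs σ t Q) :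
    (RAMProg.ite c p q).Runs σ (t + 1) Q := by
  by_cases hc : c.Holds σ
  · obtain ⟨t', τ, h, ht, hQ⟩ := hp hc
    exact ⟨t' + 1, τ, .ite_true hc h, Nat.add_le_add_right ht 1, hQ⟩
  · obtain ⟨t', τ, h, ht, hQ⟩ := hq hc
    exact ⟨t' + 1, τ, .ite_false hc h, Nat.add_le_add_right ht 1, hQ⟩

theorem whileLoop {c : RAMTest} {N : ℕ} (I : ℕ → RAMState → Prop)
    (hc : ∀ j ≤ N, ∀ τ, I j τ → (c.Holds τ ↔ j < N))
    (hbody : ∀ j < N, ∀ τ, I j τ → p.Runs τ t (I (j + 1))) {j : ℕ} (hj : j ≤ N) (h : I j σ) :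
    (RAMProg.while c p).Runs σ ((N - j) * (t + 1) + 1) (I N) := by
  induction hj using Nat.decreasingInduction generalizing σ with
  | self => exact ⟨1, σ, .while_false fun hσ => lt_irrefl _ ((hc N le_rfl σ h).1 hσ), by omega, h⟩
  | of_succ j hj ih =>
    obtain ⟨t₁, τ, h₁, ht₁, hτ⟩ := hbody j hj σ h
    obtain ⟨t₂, ρ, h₂, ht₂, hρ⟩ := ih hτ
    refine ⟨t₁ + t₂ + 1, ρ, .while_true ((hc j hj.le σ h).2 hj) h₁ h₂, ?_, hρ⟩
    rw [show N - j = N - (j + 1) + 1 by omega, add_mul]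
    omega

end Runs

/-- The register holding the constant `1` by which loops increment their counters. -/
def unit : ℕ := 2

/-- The loop over the values `0, 1, …` of register `c` below the value of register `b`. -/
def forLoop (c b : ℕ) (p : RAMProg) : RAMProg :=
  .natConst c 0 ⨟ .while (.natLt c b) (p ⨟ .natConst unit 1 ⨟ .natAdd c c unit)

/-- A program executed only if the registers `a` and `b` hold the same number. -/
def ifEq (a b : ℕ) (p : RAMProg) : RAMProg :=
  .ite (.natLt a b) .skip (.ite (.natLt b a) .skip p)

@[simp] theorem run_ifEq (a b : ℕ) (p : RAMProg) (σ : RAMState) :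
    (ifEq a b p).run σ = if σ.natReg a = σ.natReg b then p.run σ else σ := by
  rcases lt_trichotomy (σ.natReg a) (σ.natReg b) with h | h | h <;>
    simp [ifEq, run, RAMTest.Holds, h, h.not_gt, Nat.ne_of_lt, Nat.ne_of_gt]

@[simp] theorem safe_ifEq (a b : ℕ) (p : RAMProg) (σ : RAMState) :
    (ifEq a b p).Safe σ ↔ (σ.natReg a = σ.natReg b → p.Safe σ) := by
  rcases lt_trichotomy (σ.natReg a) (σ.natReg b) with h | h | h <;>
    simp [ifEq, Safe, RAMTest.Holds, h, h.not_gt, Nat.ne_of_lt, Nat.ne_of_gt]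

theorem Runs.forLoop {c b N : ℕ} (I : ℕ → RAMState → Prop) (hN : σ.natReg b = N)
    (hb : .natReg b ∉ (forLoop c b p).targets)
    (hc : .natReg c ∉ (p ⨟ .natConst unit 1).targets) (h₀ : I 0 (σ.setNat c 0))
    (hbody : ∀ j < N, ∀ τ, (forLoop c b p).Frame σ τ → τ.natReg c = j → I j τ →
      p.Runs τ t fun ρ => I (j + 1) ((ρ.setNat unit 1).setNat c (j + 1))) :
    (forLoop c b p).Runs σ (N * (t + 3) + 2) (I N) := by
  have initial : (natConst c 0).Runs σ 1 (· = σ.setNat c 0) := .of_safe trivial rfl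
  refine .mono (.seq (t := N * (t + 3) + 1) initial ?_) (by omega) fun _ => id
  rintro _ frame rfl
  have frame_initial := frame.mono (q := RAMProg.forLoop c b p) (by simp [RAMProg.forLoop, targets])
  refine .mono (.whileLoop (t := t + 2)
    (fun j τ => (RAMProg.forLoop c b p).Frame σ τ ∧ τ.natReg c = j ∧ I j τ)
    (fun j _ τ ⟨frame, counter, _⟩ => ?_) (fun j hj τ ⟨frame, counter, hI⟩ => ?_) N.zero_le
    ⟨frame_initial, by simp, h₀⟩) le_rfl fun _ h => h.2.2
  · rw [RAMTest.Holds, counter, frame.natReg hb, hN]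
  · have body : (p ⨟ natConst unit 1 ⨟ natAdd c c unit).Runs τ (t + 2) fun ρ =>
        ρ.natReg c = j + 1 ∧ I (j + 1) ρ := by
      refine .seq (hbody j hj τ frame counter hI) fun ρ frame_body hρ =>
        .of_safe ⟨trivial, trivial⟩ ?_
      have counter_ρ : ρ.natReg c = j := by
        rw [frame_body.natReg fun h => hc (by simp [targets, h]), counter]
      have next : (natConst unit 1 ⨟ natAdd c c unit).run ρ =
          (ρ.setNat unit 1).setNat c (j + 1) := by
        simp [run, RAMState.setNat, counter_ρ, show c ≠ unit by rintro rfl; simp [targets] at hc]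
      rw [next]
      exact ⟨by simp, hρ⟩
    exact body.frame.mono le_rfl fun ρ h =>
      ⟨frame.trans (h.1.mono (by simp [RAMProg.forLoop, targets])), h.2⟩

end RAMProg

/-! ### Arrays with two indices -/

/-- Entry `(i, l)` of the matrix with `s` rows stored column by column in the real array `m`. -/
def RAMState.entry (σ : RAMState) (m s i l : ℕ) : ℝ := σ.realArr m (l * s + i)

/-- Row `i` of the matrix with `s` rows stored in the real array `m` has been replaced by `f` in the
columns before column `j`. -/
def RAMState.RowFilled (m s i j : ℕ) (f : ℕ → ℝ) (σ τ : RAMState) : Prop :=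
  ∀ i' < s, ∀ l, τ.entry m s i' l = if i' = i ∧ l < j then f l else σ.entry m s i' l

theorem mul_add_inj_of_lt {s i i' l l' : ℕ} (hi : i < s) (hi' : i' < s) :
    l' * s + i' = l * s + i ↔ i' = i ∧ l' = l := by
  refine ⟨fun h => ?_, by rintro ⟨rfl, rfl⟩; rfl⟩
  have row_eq : i' = i := by
    simpa [Nat.mod_eq_of_lt hi, Nat.mod_eq_of_lt hi'] using congrArg (· % s) h
  subst row_eq
  exact ⟨rfl, Nat.eq_of_mul_eq_mul_right (by omega) (Nat.add_right_cancel h)⟩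

namespace RAMState.RowFilled

variable {m s i j : ℕ} {f : ℕ → ℝ} {σ τ ρ : RAMState}

theorem zero (h : τ.realArr m = σ.realArr m) : RowFilled m s i 0 f σ τ := by
  simp [RowFilled, entry, h]

theorem succ (h : RowFilled m s i j f σ τ) (hi : i < s)
    (hρ : ρ.realArr m = Function.update (τ.realArr m) (j * s + i) (f j)) :
    RowFilled m s i (j + 1) f σ ρ := by
  intro i' hi' l
  have old := h i' hi' l
  simp only [entry] at old
  simp only [entry, hρ, Function.update_apply, mul_add_inj_of_lt hi hi', old,
    Nat.lt_succ_iff_lt_or_eq]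
  grind

end RAMState.RowFilled

namespace RAMProg

theorem Runs.fillRow {p : RAMProg} {σ : RAMState} {c b N m s i : ℕ} {f : ℕ → ℝ}
    (hN : σ.natReg b = N) (hi : i < s) (hb : .natReg b ∉ (RAMProg.forLoop c b p).targets)
    (hc : .natReg c ∉ (p ⨟ .natConst unit 1).targets)
    (hbody : ∀ j < N, ∀ τ, (RAMProg.forLoop c b p).Frame σ τ → τ.natReg c = j →
      σ.RowFilled m s i j f τ →
        p.Safe τ ∧ (p.run τ).realArr m = Function.update (τ.realArr m) (j * s + i) (f j)) :
    (RAMProg.forLoop c b p).Runs σ (N * (p.cost + 3) + 2) (σ.RowFilled m s i N f) :=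
  .forLoop (σ.RowFilled m s i · f) hN hb hc (.zero rfl) fun j hj τ frame counter h =>
    have ⟨safe, effect⟩ := hbody j hj τ frame counter h
    .of_safe safe (h.succ hi effect)

end RAMProg

/-! ### Elimination on the machine -/

namespace CoverProg

open RAMProg

-- Registers for natural numbers: the input consists of `size` and `start`.
def size : ℕ := 0
def start : ℕ := 1
def width : ℕ := 3
def last : ℕ := 4
def step : ℕ := 5
def mask : ℕ := 6
def pivot : ℕ := 7
def row : ℕ := 8
def col : ℕ := 9
def rem : ℕ := 10
def bit : ℕ := 11
def addr : ℕ := 12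
def count : ℕ := 13
def value : ℕ := 14
def card : ℕ := 15

-- Arrays of natural numbers.
def powers : ℕ := 0
def tableOffset : ℕ := 1
def matrixOffset : ℕ := 2

-- Registers for real numbers.
def result : ℕ := 0
def coeff : ℕ := 1
def fst : ℕ := 2
def snd : ℕ := 3

-- Arrays of real numbers.
def weights : ℕ := 0
def table : ℕ := 1
def matrix : ℕ := 2

/-- The constant data of the computation: `matrix` has `n` rows and `n + 1` columns, `table` has
`2 ^ n` rows and `n` columns. -/
structure Env (n : ℕ) (W : ℕ → ℕ → ℝ) (σ : RAMState) : Prop where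
  size : σ.natReg size = n
  width : σ.natReg width = n + 1
  last : σ.natReg last = 2 ^ n - 1
  powers : ∀ j < n, σ.natArr powers j = 2 ^ j
  tableOffset : ∀ l < n, σ.natArr tableOffset l = l * 2 ^ n
  matrixOffset : ∀ l ≤ n, σ.natArr matrixOffset l = l * n
  weights : ∀ i < n, ∀ l < n, σ.entry weights n i l = W i l

/-- The program does not write to the constant data. -/
abbrev KeepsEnv (p : RAMProg) : Prop :=
  (∀ r ∈ [size, width, last], .natReg r ∉ p.targets) ∧
  (∀ m ∈ [powers, tableOffset, matrixOffset], .natArr m ∉ p.targets) ∧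
  .realArr weights ∉ p.targets

theorem Env.of_frame {n : ℕ} {W : ℕ → ℕ → ℝ} {p : RAMProg} {σ τ : RAMState} (env : Env n W σ)
    (frame : p.Frame σ τ) (hp : KeepsEnv p := by decide) : Env n W τ := by
  obtain ⟨hreg, harr, hw⟩ := hp
  simp only [List.forall_mem_cons] at hreg harr
  constructor
  · rw [frame.natReg hreg.1, env.size]
  · rw [frame.natReg hreg.2.1, env.width]
  · rw [frame.natReg hreg.2.2.1, env.last]
  · rw [frame.natArr harr.1]
    exact env.powers
  · rw [frame.natArr harr.2.1]
    exact env.tableOffset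
  · rw [frame.natArr harr.2.2.1]
    exact env.matrixOffset
  · simp only [RAMState.entry, frame.realArr hw]
    exact env.weights

/-- Register `x` is loaded with the entry in row `i` and column `l` of the matrix in array `m`;
array `t` contains the positions at which the columns begin. -/
def loadEntry (x m t i l : ℕ) : RAMProg :=
  .natLoad addr t l ⨟ .natAdd addr addr i ⨟ .realLoad x m addr

/-- Register `x` is stored as the entry in row `i` and column `l` of the matrix in array `m`;
array `t` contains the positions at which the columns begin. -/
def storeEntry (m t i l x : ℕ) : RAMProg :=
  .natLoad addr t l ⨟ .natAdd addr addr i ⨟ .realStore m addr x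

attribute [local simp] RAMState.setNat RAMState.setReal RAMState.setNatArr RAMState.setRealArr
  run Safe loadEntry storeEntry RAMState.entry

/-- The multiple of row `pivot` which has to be subtracted from row `row`. -/
def elimCoeff : RAMProg :=
  loadEntry coeff matrix matrixOffset row pivot ⨟ loadEntry fst matrix matrixOffset pivot pivot ⨟
  .realDiv coeff coeff fst ⨟ ifEq row pivot (.realConst coeff 0)

/-- The subtraction of `coeff` times row `pivot` from row `row`. -/
def subtractRow : RAMProg :=
  forLoop col width (loadEntry fst matrix matrixOffset row col ⨟
    loadEntry snd matrix matrixOffset pivot col ⨟ .realMul snd coeff snd ⨟ .realSub fst fst snd ⨟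
    storeEntry matrix matrixOffset row col fst)

/-- The elimination step with pivot row `pivot`. -/
def eliminateColumn : RAMProg := forLoop row size (elimCoeff ⨟ subtractRow)

/-- The elimination steps for all pivot rows. -/
def elimination : RAMProg := forLoop pivot size eliminateColumn

variable {n : ℕ} {W : ℕ → ℕ → ℝ} {σ : RAMState} {i k : ℕ}

theorem elimCoeff_runs (env : Env n W σ) (hk : k < n) (hrow : σ.natReg row = i)
    (hpivot : σ.natReg pivot = k) (hM : σ.entry matrix n k k ≠ 0) :
    elimCoeff.Runs σ 10 fun τ =>
      τ.realReg coeff = if i = k then 0 else σ.entry matrix n i k / σ.entry matrix n k k := by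
  refine .of_safe ?_ ?_
  · simpa +decide [elimCoeff, hrow, hpivot, env.matrixOffset, hk.le] using hM
  · by_cases hik : i = k <;> simp +decide [elimCoeff, hrow, hpivot, env.matrixOffset, hk.le, hik]

theorem subtractRow_runs (env : Env n W σ) (hi : i < n) (hk : k < n) (hrow : σ.natReg row = i)
    (hpivot : σ.natReg pivot = k) :
    subtractRow.Runs σ (14 * n + 16) (σ.RowFilled matrix n i (n + 1) fun l =>
      σ.entry matrix n i l - σ.realReg coeff * σ.entry matrix n k l) := by
  refine (Runs.fillRow env.width hi (by decide) (by decide)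
    fun j hj τ frame hcol filled => ⟨by simp, ?_⟩).le ?_
  · have row_eq : τ.natReg row = i := (frame.natReg (by decide)).trans hrow
    have pivot_eq : τ.natReg pivot = k := (frame.natReg (by decide)).trans hpivot
    have coeff_eq : τ.realReg coeff = σ.realReg coeff := frame.realReg (by decide)
    have offset_eq := (env.of_frame frame).matrixOffset j (by omega)
    have unchanged (i' : ℕ) (hi' : i' < n) := filled i' hi' j
    simp only [lt_irrefl, and_false, if_false, RAMState.entry] at unchanged
    simp +decide [hcol, row_eq, pivot_eq, coeff_eq, offset_eq, unchanged, hi, hk]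
  · simp only [loadEntry, storeEntry, cost]
    omega

theorem elimRow_runs (env : Env n W σ) (hi : i < n) (hk : k < n) (hrow : σ.natReg row = i)
    (hpivot : σ.natReg pivot = k) (hM : σ.entry matrix n k k ≠ 0) :
    (elimCoeff ⨟ subtractRow).Runs σ (14 * n + 26)
      (σ.RowFilled matrix n i (n + 1) (elimStep k (σ.entry matrix n) i)) := by
  refine ((elimCoeff_runs env hk hrow hpivot hM).seq fun τ frame coeff_eq =>
    (subtractRow_runs (env.of_frame frame) hi hk ((frame.natReg (by decide)).trans hrow)
      ((frame.natReg (by decide)).trans hpivot)).mono le_rfl fun ρ filled => ?_).le (by omega)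
  have matrix_eq : τ.realArr matrix = σ.realArr matrix := frame.realArr (by decide)
  simpa only [RAMState.RowFilled, coeff_eq, elimStep, RAMState.entry, matrix_eq] using filled

theorem eliminateColumn_runs (env : Env n W σ) (hk : k < n) (hpivot : σ.natReg pivot = k)
    (hM : σ.entry matrix n k k ≠ 0) :
    eliminateColumn.Runs σ (n * (14 * n + 29) + 2) fun τ =>
      ∀ i < n, ∀ l ≤ n, τ.entry matrix n i l = elimStep k (σ.entry matrix n) i l := by
  let M := σ.entry matrix n
  refine (Runs.forLoop (fun j τ => ∀ i < n, ∀ l ≤ n,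
    τ.entry matrix n i l = if i < j then elimStep k M i l else M i l) env.size (by decide)
    (by decide) (by simp [M]) fun j hj τ frame hrow h => ?_).mono le_rfl
      fun τ h i hi l hl => by rw [h i hi l hl, if_pos hi]
  have pivot_row (l : ℕ) (hl : l ≤ n) : τ.entry matrix n k l = M k l := by
    rw [h k hk l hl, elimStep_pivot_row, ite_self]
  have current_row (l : ℕ) (hl : l ≤ n) : τ.entry matrix n j l = M j l := by
    rw [h j hj l hl, if_neg (lt_irrefl j)]
  refine (elimRow_runs (env.of_frame frame) hj hk hrow ((frame.natReg (by decide)).trans hpivot)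
    (by rwa [pivot_row k hk.le])).mono le_rfl fun ρ filled i hi l hl => ?_
  change ρ.entry matrix n i l = _
  rw [filled i hi l]
  by_cases hij : i = j
  · rw [if_pos ⟨hij, by omega⟩, hij, if_pos j.lt_succ_self, elimStep, elimStep, pivot_row l hl,
      pivot_row k hk.le, current_row l hl, current_row k hk.le]
  · rw [if_neg fun h => hij h.1, h i hi l hl]
    exact if_congr (by omega) rfl rfl

theorem elimination_runs (env : Env n W σ) {M : ℕ → ℕ → ℝ} (hM : LeadingRegular n M)
    (h : ∀ i < n, ∀ l ≤ n, σ.entry matrix n i l = M i l) :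
    elimination.Runs σ (n * (n * (14 * n + 29) + 5) + 2) fun τ =>
      ∀ i < n, ∀ l ≤ n, τ.entry matrix n i l = elim M n i l := by
  refine Runs.forLoop (fun k τ => ∀ i < n, ∀ l ≤ n, τ.entry matrix n i l = elim M k i l) env.size
    (by decide) (by decide) h fun k hk τ frame hpivot h => ?_
  refine (eliminateColumn_runs (env.of_frame frame) hk hpivot
    (by rw [h k hk k hk.le]; exact hM.pivot_ne_zero hk)).mono le_rfl fun ρ hρ i hi l hl =>
      (hρ i hi l hl).trans (elimStep_congr h hk hi hl)

/-! ### Assembling and solving the linear system of one set -/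

/-- The total weight of the edges at vertex `row`. -/
def degreeSum : RAMProg :=
  .realConst coeff 0 ⨟
  forLoop col size (loadEntry fst weights matrixOffset row col ⨟ .realAdd coeff coeff fst)

/-- The coefficients in row `row` of the system for a vertex of the current set. -/
def laplaceEntries : RAMProg :=
  forLoop col size (.realConst fst 0 ⨟ ifEq col row (.realAdd fst fst coeff) ⨟
    loadEntry snd weights matrixOffset row col ⨟ .realSub fst fst snd ⨟
    storeEntry matrix matrixOffset row col fst)

/-- Row `row` of the system for a vertex of the current set. -/
def laplaceRow : RAMProg :=
  degreeSum ⨟ laplaceEntries ⨟ storeEntry matrix matrixOffset row size coeff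

/-- The coefficients in row `row` of the system for a vertex outside the current set. -/
def unitEntries : RAMProg :=
  forLoop col size (.realConst fst 0 ⨟ ifEq col row (.realConst fst 1) ⨟
    storeEntry matrix matrixOffset row col fst)

/-- Row `row` of the system for a vertex outside the current set, whose value is known: it has been
stored in the row of the table for the set enlarged by this vertex. -/
def unitRow : RAMProg :=
  unitEntries ⨟ .natAdd bit mask bit ⨟ loadEntry fst table tableOffset bit row ⨟
  storeEntry matrix matrixOffset row size fst

/-- Row `row` of the system; register `rem` holds the bits of the current set up to this row. -/
def systemRow : RAMProg :=
  .ite (.natLt rem bit) unitRow (.natSub rem rem bit ⨟ laplaceRow)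

/-- The next row, from the last one to the first one, and its power of two. -/
def nextRow : RAMProg :=
  .natSub row size count ⨟ .natConst unit 1 ⨟ .natSub row row unit ⨟ .natLoad bit powers row

/-- Register `d` is loaded with the contents of register `a`. -/
def natCopy (d a : ℕ) : RAMProg := .natConst d 0 ⨟ .natAdd d d a

/-- The system for the set with binary number `mask`. -/
def assemble : RAMProg :=
  natCopy rem mask ⨟ forLoop count size (nextRow ⨟ systemRow)

/-- The solution of the diagonal system is stored as row `mask` of the table. -/
def storeSolution : RAMProg :=
  forLoop col size (loadEntry fst matrix matrixOffset col size ⨟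
    loadEntry snd matrix matrixOffset col col ⨟ .realDiv fst fst snd ⨟
    storeEntry table tableOffset mask col fst)

theorem degreeSum_runs (env : Env n W σ) (hi : i < n) (hrow : σ.natReg row = i) :
    degreeSum.Runs σ (7 * n + 3) fun τ => τ.realReg coeff = ∑ m ∈ Finset.range n, W i m := by
  have initial : (realConst coeff 0).Runs σ 1 fun τ => τ.realReg coeff = 0 :=
    .of_safe trivial (by simp)
  refine (initial.seq fun τ frame h₀ => Runs.forLoop
    (fun j ρ => ρ.realReg coeff = ∑ m ∈ Finset.range j, W i m) (env.of_frame frame).size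
    (by decide) (by decide) (by simpa using h₀) fun j hj ρ frame_ρ hcol h =>
      .of_safe (by simp) ?_).le (by simp only [loadEntry, cost]; omega)
  have env_ρ := (env.of_frame frame).of_frame frame_ρ
  have row_eq : ρ.natReg row = i := by
    rw [frame_ρ.natReg (by decide), frame.natReg (by decide), hrow]
  have weight_eq := env_ρ.weights i hi j hj
  simp only [RAMState.entry] at weight_eq
  simp +decide [hcol, row_eq, env_ρ.matrixOffset j hj.le, weight_eq, h, Finset.sum_range_succ]

theorem laplaceEntries_runs (env : Env n W σ) (hi : i < n) (hrow : σ.natReg row = i)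
    (hcoeff : σ.realReg coeff = ∑ m ∈ Finset.range n, W i m) {P : ℕ} (hP : P.testBit i = true)
    (T : ℕ → ℝ) :
    laplaceEntries.Runs σ (14 * n + 2) (σ.RowFilled matrix n i n (systemMatrix n W P T i)) := by
  refine (Runs.fillRow env.size hi (by decide) (by decide)
    fun j hj τ frame hcol _ => ⟨by simp, ?_⟩).le ?_
  · have row_eq : τ.natReg row = i := (frame.natReg (by decide)).trans hrow
    have coeff_eq := (frame.realReg (by decide)).trans hcoeff
    have offset_eq := (env.of_frame frame).matrixOffset j hj.le
    have weight_eq := (env.of_frame frame).weights i hi j hj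
    simp only [RAMState.entry] at weight_eq
    rcases eq_or_ne j i with rfl | hji
    · simp +decide [systemMatrix, hcol, row_eq, coeff_eq, offset_eq, weight_eq, hP, hj.ne]
    · simp +decide [systemMatrix, hcol, row_eq, offset_eq, weight_eq, hP, hj.ne, hji]
  · simp +arith [loadEntry, storeEntry, ifEq, cost, mul_comm n]

theorem laplaceRow_runs (env : Env n W σ) (hi : i < n) (hrow : σ.natReg row = i) {P : ℕ}
    (hP : P.testBit i = true) (T : ℕ → ℝ) :
    laplaceRow.Runs σ (21 * n + 8)
      (σ.RowFilled matrix n i (n + 1) (systemMatrix n W P T i)) := by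
  refine ((degreeSum_runs env hi hrow).seq fun τ frame hcoeff =>
    have env := env.of_frame frame
    have hrow := (frame.natReg (by decide)).trans hrow
    (laplaceEntries_runs env hi hrow hcoeff hP T).seq fun ρ frame_ρ filled =>
      .of_safe (by simp) (RAMState.RowFilled.succ (τ := ρ) ?_ hi ?_)).le
        (by simp +arith [storeEntry, cost])
  · simpa only [RAMState.RowFilled, RAMState.entry, frame.realArr (m := matrix) (by decide)]
      using filled
  · have env_ρ := env.of_frame frame_ρ
    have row_eq := (frame_ρ.natReg (by decide)).trans hrow
    have coeff_eq := (frame_ρ.realReg (by decide)).trans hcoeff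
    simp +decide [systemMatrix, env_ρ.size, env_ρ.matrixOffset, row_eq, coeff_eq, hP]

theorem unitEntries_runs (env : Env n W σ) (hi : i < n) (hrow : σ.natReg row = i) {P : ℕ}
    (hP : P.testBit i = false) (T : ℕ → ℝ) :
    unitEntries.Runs σ (10 * n + 2) (σ.RowFilled matrix n i n (systemMatrix n W P T i)) := by
  refine (Runs.fillRow env.size hi (by decide) (by decide)
    fun j hj τ frame hcol _ => ⟨by simp, ?_⟩).le ?_
  · have row_eq : τ.natReg row = i := (frame.natReg (by decide)).trans hrow
    have offset_eq := (env.of_frame frame).matrixOffset j hj.le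
    rcases eq_or_ne j i with rfl | hji
    · simp +decide [systemMatrix, hcol, row_eq, offset_eq, hP, hj.ne]
    · simp +decide [systemMatrix, hcol, row_eq, offset_eq, hP, hj.ne, hji]
  · simp +arith [storeEntry, ifEq, cost, mul_comm n]

theorem unitRow_runs (env : Env n W σ) (hi : i < n) (hrow : σ.natReg row = i) {P : ℕ}
    (hmask : σ.natReg mask = P) (hbit : σ.natReg bit = 2 ^ i) (hP : P.testBit i = false)
    {T : ℕ → ℝ} (hT : σ.entry table (2 ^ n) (P + 2 ^ i) i = T i) :
    unitRow.Runs σ (10 * n + 9)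
      (σ.RowFilled matrix n i (n + 1) (systemMatrix n W P T i)) := by
  refine ((unitEntries_runs env hi hrow hP T).seq fun τ frame filled =>
    .of_safe (by simp) (filled.succ hi ?_)).le (by simp +arith [loadEntry, storeEntry, cost])
  have env_τ := env.of_frame frame
  have row_eq := (frame.natReg (by decide)).trans hrow
  have mask_eq := (frame.natReg (by decide)).trans hmask
  have bit_eq := (frame.natReg (by decide)).trans hbit
  have table_eq : τ.realArr table = σ.realArr table := frame.realArr (by decide)
  simp only [RAMState.entry, ← table_eq] at hT
  simp +decide [systemMatrix, env_τ.size, env_τ.matrixOffset, env_τ.tableOffset i hi, row_eq,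
    mask_eq, bit_eq, hT, hP]

theorem systemRow_runs (env : Env n W σ) (hi : i < n) (hrow : σ.natReg row = i) {P : ℕ}
    (hmask : σ.natReg mask = P) (hbit : σ.natReg bit = 2 ^ i)
    (hrem : σ.natReg rem = P % 2 ^ (i + 1)) {T : ℕ → ℝ}
    (hT : σ.entry table (2 ^ n) (P + 2 ^ i) i = T i) :
    systemRow.Runs σ (21 * n + 10) fun τ =>
      σ.RowFilled matrix n i (n + 1) (systemMatrix n W P T i) τ ∧ τ.natReg rem = P % 2 ^ i := by
  have test_iff : (RAMTest.natLt rem bit).Holds σ ↔ P.testBit i = false := by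
    rw [RAMTest.Holds, hrem, hbit, testBit_eq_false_iff_mod_lt]
  refine .ite (t := 21 * n + 9) (fun h => ?_) fun h => ?_
  · have hP := test_iff.1 h
    refine (unitRow_runs env hi hrow hmask hbit hP hT).frame.mono (by omega)
      fun τ ⟨frame, filled⟩ => ⟨filled, ?_⟩
    rw [frame.natReg (by decide), hrem, mod_two_pow_succ_of_testBit_eq_false hP]
  · have hP : P.testBit i = true := by simpa only [test_iff, Bool.not_eq_false] using h
    have subtract : (RAMProg.natSub rem rem bit).Runs σ 1 fun τ => τ.natReg rem = P % 2 ^ i :=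
      .of_safe trivial (by simp [hrem, hbit, mod_two_pow_succ_sub P i hP])
    refine (subtract.seq fun τ frame hτ => ((laplaceRow_runs (env.of_frame frame) hi
      ((frame.natReg (by decide)).trans hrow) hP T).frame.mono le_rfl
        fun ρ ⟨frame_ρ, filled⟩ => ⟨?_, ?_⟩)).le (by omega)
    · simpa only [RAMState.RowFilled, RAMState.entry, frame.realArr (m := matrix) (by decide)]
        using filled
    · rw [frame_ρ.natReg (by decide), hτ]

theorem nextRow_runs (env : Env n W σ) {j : ℕ} (hj : j < n) (hcount : σ.natReg count = j) :
    nextRow.Runs σ 4 fun τ =>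
      τ.natReg row = n - (j + 1) ∧ τ.natReg bit = 2 ^ (n - (j + 1)) :=
  .of_safe (by simp [nextRow]) (by
    simp +decide [nextRow, hcount, env.size, Nat.sub_sub, env.powers (n - (j + 1)) (by omega)])

theorem nextRow_systemRow_runs (env : Env n W σ) {P : ℕ} (hmask : σ.natReg mask = P)
    {T : ℕ → ℝ} (hT : ∀ i < n, σ.entry table (2 ^ n) (P + 2 ^ i) i = T i) {j : ℕ} (hj : j < n)
    (hcount : σ.natReg count = j) (hrem : σ.natReg rem = P % 2 ^ (n - j)) :
    (nextRow ⨟ systemRow).Runs σ (21 * n + 14) fun τ =>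
      σ.RowFilled matrix n (n - (j + 1)) (n + 1) (systemMatrix n W P T (n - (j + 1))) τ ∧
        τ.natReg rem = P % 2 ^ (n - (j + 1)) := by
  refine ((nextRow_runs env hj hcount).seq fun τ frame ⟨hrow, hbit⟩ =>
    (systemRow_runs (T := T) (env.of_frame frame) (by omega) hrow
      ((frame.natReg (by decide)).trans hmask) hbit ?_ ?_).mono le_rfl
        fun ρ ⟨filled, hρ⟩ => ⟨?_, hρ⟩).le (by omega)
  · rw [frame.natReg (by decide), hrem, show n - (j + 1) + 1 = n - j by omega]
  · simpa only [RAMState.entry, frame.realArr (m := table) (by decide)] using hT _ (by omega)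
  · simpa only [RAMState.RowFilled, RAMState.entry, frame.realArr (m := matrix) (by decide)]
      using filled

theorem assemble_runs (env : Env n W σ) {P : ℕ} (hP : P < 2 ^ n) (hmask : σ.natReg mask = P)
    {T : ℕ → ℝ} (hT : ∀ i < n, σ.entry table (2 ^ n) (P + 2 ^ i) i = T i) :
    assemble.Runs σ (n * (21 * n + 17) + 4) fun τ =>
      ∀ i < n, ∀ l ≤ n, τ.entry matrix n i l = systemMatrix n W P T i l := by
  have initial : (natCopy rem mask).Runs σ 2 fun τ => τ.natReg rem = P :=
    .of_safe (by simp [natCopy]) (by simp +decide [natCopy, hmask])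
  refine (initial.seq fun τ frame hrem => (Runs.forLoop (t := 21 * n + 14)
    (fun j τ => τ.natReg rem = P % 2 ^ (n - j) ∧ ∀ i < n, n - j ≤ i → ∀ l ≤ n,
      τ.entry matrix n i l = systemMatrix n W P T i l)
    (env.of_frame frame).size (by decide) (by decide) ?_
    fun j hj ρ frame_ρ hcount ⟨hrem, h⟩ => ?_).mono le_rfl
      fun ρ h i hi => h.2 i hi (by omega)).le (by simp +arith)
  · exact ⟨by simp +decide [hrem, Nat.mod_eq_of_lt hP], by omega⟩
  have frame_ρ : assemble.Frame σ ρ :=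
    (frame.mono (by decide)).trans (frame_ρ.mono (by decide))
  refine (nextRow_systemRow_runs (T := T) (env.of_frame frame_ρ)
    ((frame_ρ.natReg (by decide)).trans hmask) ?_ hj hcount hrem).mono le_rfl
      fun υ ⟨filled, hrem⟩ => ⟨by simpa +decide using hrem, fun i hi hij l hl => ?_⟩
  · simpa only [RAMState.entry, frame_ρ.realArr (m := table) (by decide)] using hT
  · change υ.entry matrix n i l = _
    rw [filled i hi l]
    split_ifs with hil
    · rw [hil.1]
    · exact h i hi (by omega) l hl

theorem storeSolution_runs (env : Env n W σ) {P : ℕ} (hP : P < 2 ^ n) (hmask : σ.natReg mask = P)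
    {M : ℕ → ℕ → ℝ} (h : ∀ i < n, ∀ l ≤ n, σ.entry matrix n i l = M i l)
    (hM : ∀ i < n, M i i ≠ 0)
    {x : ℕ → ℝ} (hx : ∀ i < n, M i n / M i i = x i) :
    storeSolution.Runs σ (13 * n + 2) (σ.RowFilled table (2 ^ n) P n x) := by
  refine (Runs.fillRow env.size hP (by decide) (by decide) fun j hj τ frame hcol _ => ?_).le
    (by simp +arith [loadEntry, storeEntry, cost, mul_comm n])
  have env_τ := env.of_frame frame
  have mask_eq := (frame.natReg (by decide)).trans hmask
  have matrix_eq : τ.realArr matrix = σ.realArr matrix := frame.realArr (by decide)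
  have last_eq := h j hj n le_rfl
  have diag_eq := h j hj j hj.le
  simp only [RAMState.entry, ← matrix_eq] at last_eq diag_eq
  simp +decide [hcol, mask_eq, env_τ.size, env_τ.matrixOffset, env_τ.tableOffset j hj, hj.le,
    last_eq, diag_eq, hM j hj, hx j hj]

/-! ### The table of hitting times -/

variable {G : WeightedGraph (Fin n)}

/-- The row of the table for the set with binary number `mask` is computed. -/
def tableRow : RAMProg := assemble ⨟ elimination ⨟ storeSolution

/-- The binary number of the next set, from the second largest one to zero. -/
def nextSet : RAMProg :=
  .natSub mask last step ⨟ .natConst unit 1 ⨟ .natSub mask mask unit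

/-- The table is computed row by row. -/
def mainLoop : RAMProg := forLoop step last (nextSet ⨟ tableRow)

/-- Position `j` of array `m` is filled with the sum of register `value` and `j` times register
`x`; the register `x` may be `value` itself, which is then doubled in each step. -/
def tabulate (m b x : ℕ) : RAMProg :=
  forLoop row b (.natStore m row value ⨟ .natAdd value value x)

/-- The powers of two, and the number of columns of the matrix. -/
def powersTable : RAMProg :=
  (.natConst unit 1 ⨟ .natAdd width size unit ⨟ .natConst value 1) ⨟ tabulate powers size value

/-- The number of rows of the table, and the binary number of the largest set. -/
def cardinals : RAMProg :=
  natCopy card value ⨟ .natConst unit 1 ⨟ .natSub last card unit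

/-- Array `m` is filled with the multiples of register `x`. -/
def multiples (m b x : ℕ) : RAMProg := .natConst value 0 ⨟ tabulate m b x

/-- The positions at which the columns of the table and of the matrix begin. -/
def offsetTables : RAMProg := multiples tableOffset size card ⨟ multiples matrixOffset width size

/-- The constant data of the computation. -/
def initialization : RAMProg := powersTable ⨟ cardinals ⨟ offsetTables

/-- The program which computes cover times; the result is the entry of the table for the empty set
and the starting vertex. -/
def coverProg : RAMProg :=
  initialization ⨟ mainLoop ⨟ .natConst mask 0 ⨟ loadEntry result table tableOffset mask start

theorem tableRow_runs (hG : G.graph.Connected) (env : Env n (natWeight G) σ) {P : ℕ}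
    (hP : P < 2 ^ n - 1) (hmask : σ.natReg mask = P)
    (h : ∀ i < n, P.testBit i = false →
      σ.entry table (2 ^ n) (P + 2 ^ i) i = coverValue G (P + 2 ^ i) i) :
    tableRow.Runs σ (14 * n ^ 3 + 50 * n ^ 2 + 35 * n + 8)
      (σ.RowFilled table (2 ^ n) P n (coverValue G P)) := by
  let T : ℕ → ℝ := fun i => σ.entry table (2 ^ n) (P + 2 ^ i) i
  have regular := leadingRegular_systemMatrix hG hP T
  refine ((assemble_runs (T := T) env (by omega) hmask fun _ _ => rfl).seq fun τ frame hτ =>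
    (elimination_runs (env.of_frame frame) regular hτ).seq fun ρ frame_ρ hρ =>
      (storeSolution_runs (P := P) ((env.of_frame frame).of_frame frame_ρ) (by omega) ?_ hρ
        (fun _ => regular.diag_ne_zero)
        fun _ => elim_systemMatrix_eq_coverValue hG hP h).mono le_rfl fun υ filled => ?_).le
          (le_of_eq (by ring))
  · rw [frame_ρ.natReg (by decide), frame.natReg (by decide), hmask]
  · simpa only [RAMState.RowFilled, RAMState.entry, frame_ρ.realArr (m := table) (by decide),
      frame.realArr (m := table) (by decide)] using filled

theorem nextSet_runs (env : Env n W σ) {s : ℕ} (hstep : σ.natReg step = s) :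
    nextSet.Runs σ 3 fun τ => τ.natReg mask = 2 ^ n - 1 - (s + 1) :=
  .of_safe (by simp [nextSet]) (by simp +decide [nextSet, env.last, hstep, Nat.sub_sub, add_assoc])

theorem mainLoop_runs (hG : G.graph.Connected) (env : Env n (natWeight G) σ)
    (htable : ∀ a, σ.realArr table a = 0) :
    mainLoop.Runs σ ((2 ^ n - 1) * (14 * n ^ 3 + 50 * n ^ 2 + 35 * n + 14) + 2) fun τ =>
      ∀ P < 2 ^ n, ∀ i < n, τ.entry table (2 ^ n) P i = coverValue G P i := by
  refine (Runs.forLoop (t := 3 + (14 * n ^ 3 + 50 * n ^ 2 + 35 * n + 8)) (fun s τ =>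
    ∀ P < 2 ^ n, 2 ^ n - 1 - s ≤ P → ∀ i < n, τ.entry table (2 ^ n) P i = coverValue G P i)
    env.last (by decide) (by decide) (fun P hP hle i _ => ?_)
    fun s hs τ frame hstep h => ?_).mono (le_of_eq (by ring)) fun τ h P hP => h P hP (by omega)
  · rw [show P = 2 ^ n - 1 by omega, coverValue_two_pow_sub_one]
    exact htable _
  have env_τ := env.of_frame frame
  refine (nextSet_runs env_τ hstep).seq fun ρ frame_ρ hmask =>
    (tableRow_runs hG (env_τ.of_frame frame_ρ) (by omega) hmask fun i hi hbit => ?_).mono le_rfl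
      fun υ filled P hP hle i hi => ?_
  · have := Nat.two_pow_pos i
    simpa only [RAMState.entry, frame_ρ.realArr (m := table) (by decide)] using
      h _ (add_two_pow_lt (by omega) hi hbit) (by omega) i hi
  · change υ.entry table (2 ^ n) P i = _
    rw [filled P hP i]
    split_ifs with hPs
    · rw [hPs.1]
    · simpa only [RAMState.entry, frame_ρ.realArr (m := table) (by decide)] using
        h P hP (by omega) i hi

theorem tabulate_runs {m b x N : ℕ} {f : ℕ → ℕ} (hb : .natReg b ∉ (tabulate m b x).targets)
    (hN : σ.natReg b = N) (hvalue : σ.natReg value = f 0)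
    (hf : ∀ j < N, ∀ τ, (tabulate m b x).Frame σ τ → τ.natReg value = f j →
      f j + τ.natReg x = f (j + 1)) :
    (tabulate m b x).Runs σ (5 * N + 2) fun τ =>
      τ.natReg value = f N ∧ ∀ j < N, τ.natArr m j = f j := by
  refine (Runs.forLoop (t := 2) (fun j τ => τ.natReg value = f j ∧ ∀ l < j, τ.natArr m l = f l)
    hN hb (by simp +decide [targets]) ⟨by simpa +decide using hvalue, by simp⟩
    fun j hj τ frame hrow ⟨hvalue, h⟩ => .of_safe (by simp) ⟨?_, fun l hl => ?_⟩).le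
      (by simp +arith [mul_comm N])
  · simp +decide [hvalue, hf j hj τ frame hvalue]
  · rcases Nat.lt_succ_iff_lt_or_eq.1 hl with hl | rfl
    · simp +decide [hrow, hl.ne, h l hl]
    · simp +decide [hrow, hvalue]

theorem powersTable_runs (hsize : σ.natReg size = n) :
    powersTable.Runs σ (5 * n + 5) fun τ => τ.natReg width = n + 1 ∧
      τ.natReg value = 2 ^ n ∧ ∀ j < n, τ.natArr powers j = 2 ^ j := by
  have initial : (natConst unit 1 ⨟ natAdd width size unit ⨟ natConst value 1).Runs σ 3
      fun τ => τ.natReg width = n + 1 ∧ τ.natReg value = 1 :=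
    .of_safe (by simp) (by simp +decide [hsize])
  refine (initial.seq fun τ frame ⟨hwidth, hvalue⟩ =>
    (tabulate_runs (f := (2 ^ ·)) (by decide) ((frame.natReg (by decide)).trans hsize) hvalue
      fun j _ ρ _ hρ => by rw [hρ, pow_succ, mul_two]).frame.mono le_rfl
        fun ρ ⟨frame_ρ, h⟩ => ⟨(frame_ρ.natReg (by decide)).trans hwidth, h⟩).le (by omega)

theorem cardinals_runs (hvalue : σ.natReg value = 2 ^ n) :
    cardinals.Runs σ 4 fun τ => τ.natReg card = 2 ^ n ∧ τ.natReg last = 2 ^ n - 1 :=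
  .of_safe (by simp [cardinals, natCopy]) (by simp +decide [cardinals, natCopy, hvalue])

theorem multiples_runs {m b x N d : ℕ} (hb : .natReg b ∉ (multiples m b x).targets)
    (hx : .natReg x ∉ (multiples m b x).targets) (hN : σ.natReg b = N) (hd : σ.natReg x = d) :
    (multiples m b x).Runs σ (5 * N + 3) fun τ => ∀ j < N, τ.natArr m j = j * d := by
  have initial : (natConst value 0).Runs σ 1 fun τ => τ.natReg value = 0 :=
    .of_safe trivial (by simp)
  refine (initial.seq fun τ frame hvalue => (tabulate_runs (f := (· * d))
    (fun h => hb (List.mem_append_right _ h))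
    ((frame.natReg fun h => hb (List.mem_append_left _ h)).trans hN) (by simpa using hvalue)
    fun j _ ρ frame_ρ _ => ?_).mono le_rfl fun ρ h => h.2).le (by omega)
  rw [frame_ρ.natReg fun h => hx (List.mem_append_right _ h),
    frame.natReg fun h => hx (List.mem_append_left _ h), hd, add_one_mul]

theorem offsetTables_runs (hsize : σ.natReg size = n) (hwidth : σ.natReg width = n + 1)
    (hcard : σ.natReg card = 2 ^ n) :
    offsetTables.Runs σ (10 * n + 11) fun τ =>
      (∀ l < n, τ.natArr tableOffset l = l * 2 ^ n) ∧
        ∀ l < n + 1, τ.natArr matrixOffset l = l * n := by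
  refine ((multiples_runs (by decide) (by decide) hsize hcard).seq fun τ frame h =>
    (multiples_runs (by decide) (by decide) ((frame.natReg (by decide)).trans hwidth)
      ((frame.natReg (by decide)).trans hsize)).frame.mono le_rfl
        fun ρ ⟨frame_ρ, h'⟩ => ⟨?_, h'⟩).le (by omega)
  rwa [frame_ρ.natArr (by decide)]

theorem initialization_runs (hsize : σ.natReg size = n)
    (hW : ∀ i < n, ∀ l < n, σ.entry weights n i l = W i l) :
    initialization.Runs σ (15 * n + 20) (Env n W) := by
  refine Runs.mono ((powersTable_runs hsize).frame.seq fun τ _ ⟨frame, hwidth, hvalue, hpowers⟩ =>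
    (cardinals_runs hvalue).seq fun ρ frame_ρ ⟨hcard, hlast⟩ =>
      have hsize := (frame_ρ.natReg (by decide)).trans ((frame.natReg (by decide)).trans hsize)
      (offsetTables_runs hsize ((frame_ρ.natReg (by decide)).trans hwidth) hcard).frame.mono le_rfl
        fun υ ⟨frame_υ, htable, hmatrix⟩ => ?_) (by omega) fun _ => id
  constructor
  · rw [frame_υ.natReg (by decide), hsize]
  · rw [frame_υ.natReg (by decide), frame_ρ.natReg (by decide), hwidth]
  · rw [frame_υ.natReg (by decide), hlast]
  · rwa [frame_υ.natArr (by decide), frame_ρ.natArr (by decide)]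
  · exact htable
  · simpa only [Nat.lt_succ_iff] using hmatrix
  · simpa only [RAMState.entry, frame_υ.realArr (m := weights) (by decide),
      frame_ρ.realArr (m := weights) (by decide), frame.realArr (m := weights) (by decide)] using hW

theorem entry_weights_coverInput (G : WeightedGraph (Fin n)) (start : Fin n) {i l : ℕ} (hi : i < n)
    (hl : l < n) : (coverInput G start).entry weights n i l = natWeight G i l := by
  lift i to Fin n using hi
  lift l to Fin n using hl
  have position_eq_iff (k m : Fin n) : (l : ℕ) * n + i = k * n + m ↔ m = i ∧ k = l := by
    rw [eq_comm, mul_add_inj_of_lt i.2 m.2, Fin.val_inj, Fin.val_inj]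
  simp [coverInput, weights, position_eq_iff, ite_and, natWeight_val, G.weight_symm l i]

theorem coverProg_time_le (hn : 1 ≤ n) :
    15 * n + 20 + ((2 ^ n - 1) * (14 * n ^ 3 + 50 * n ^ 2 + 35 * n + 14) + 2 + 4) ≤
      154 * n ^ 3 * 2 ^ n := by
  have one_le_cube : 1 ≤ n ^ 3 := Nat.one_le_pow _ _ hn
  have le_cube : n ≤ n ^ 3 := Nat.le_self_pow (by norm_num) n
  have sq_le_cube : n ^ 2 ≤ n ^ 3 := Nat.pow_le_pow_right hn (by norm_num)
  calc 15 * n + 20 + ((2 ^ n - 1) * (14 * n ^ 3 + 50 * n ^ 2 + 35 * n + 14) + 2 + 4)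
      ≤ 41 * n ^ 3 + (2 ^ n - 1) * (113 * n ^ 3) := by
        have := Nat.mul_le_mul_left (2 ^ n - 1)
          (show 14 * n ^ 3 + 50 * n ^ 2 + 35 * n + 14 ≤ 113 * n ^ 3 by omega)
        omega
    _ ≤ 41 * n ^ 3 * 2 ^ n + 2 ^ n * (113 * n ^ 3) :=
        Nat.add_le_add (Nat.le_mul_of_pos_right _ (Nat.two_pow_pos n))
          (Nat.mul_le_mul_right _ (Nat.sub_le _ _))
    _ = 154 * n ^ 3 * 2 ^ n := by ring

theorem coverProg_runs (hG : G.graph.Connected) (i : Fin n) :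
    coverProg.Runs (coverInput G i) (154 * n ^ 3 * 2 ^ n) fun τ =>
      τ.realReg result = (G.coverTime i).toReal := by
  refine ((initialization_runs (n := n) rfl fun k hk l hl => entry_weights_coverInput G i hk hl).seq
    fun τ frame env => (mainLoop_runs hG env fun a => ?_).seq fun ρ frame_ρ htable =>
      .of_safe (by simp) ?_).le ?_
  · rw [frame.realArr (by decide)]
    rfl
  · have start_eq : ρ.natReg start = i := by
      rw [frame_ρ.natReg (by decide), frame.natReg (by decide)]
      rfl
    have value_eq := htable 0 (by positivity) i i.2
    simp only [RAMState.entry, coverValue_zero, add_zero] at value_eq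
    simp +decide [start_eq, (env.of_frame frame_ρ).tableOffset i i.2, value_eq]
  · simpa only [loadEntry, cost] using coverProg_time_le i.pos

end CoverProg

end

theorem mainTheorem5 :
    (∀ (V : Type*) [Fintype V] [DecidableEq V] [MeasurableSpace V] [MeasurableSingletonClass V]
      (G : WeightedGraph V), G.graph.Connected →
      -- the cover time as a hitting time in the associated graph
      (∀ i, G.coverTime i = G.hitCovered {i} i) ∧
      (∀ i, G.hitCovered Finset.univ i = 0) ∧
      -- the recursion, with finite hitting times
      (∀ (P : Finset V) (i : V), i ∈ P → P ≠ Finset.univ →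
        G.hitCovered P i ≠ ∞ ∧
        G.hitCovered P i =
          1 + G.stayTime P i + ∑ j ∈ Pᶜ, G.exitProb P i j * G.hitCovered (insert j P) j) ∧
      -- `1 + s(P,i)` is the hitting time to the complement of `P`
      (∀ (P : Finset V) (i : V), i ∈ P → P ≠ Finset.univ →
        hittingTime G.step i {v | v ∉ P} = 1 + G.stayTime P i) ∧
      -- `p(P,·,j)` is the harmonic potential
      (∀ (P : Finset V) (j : V), j ∉ P → ∀ φ : V → ℝ,
        G.IsPotential P j φ ↔ φ = fun i => (G.exitProb P i j).toReal)) ∧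
    -- the algorithm
    (∃ (prog : RAMProg) (C : ℕ), ∀ (n : ℕ) (G : WeightedGraph (Fin n)), G.graph.Connected →
      ∀ i : Fin n, ∃ (t : ℕ) (σ : RAMState),
        RAMProg.Exec prog (coverInput G i) t σ ∧
        t ≤ C * n ^ 3 * 2 ^ n ∧
        σ.realReg 0 = (G.coverTime i).toReal) := by
  refine ⟨fun V _ _ _ _ G hG => ⟨G.coverTime_eq_hitCovered, G.hitCovered_univ,
    fun P i hi hP => ⟨?_, ?_⟩, fun P i hi _ => ?_, fun P j hj φ => ?_⟩,
    CoverProg.coverProg, 154, fun n G hG i => CoverProg.coverProg_runs hG i⟩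
  · exact WeightedGraph.hitCovered_ne_top hG hi
  · exact WeightedGraph.hitCovered_recursion hG hP hi
  · exact WeightedGraph.hittingTime_compl_eq_one_add_stayTime hi
  · exact WeightedGraph.isPotential_iff hG hj φ
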